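/- Let $\mathcal X=\{1,2,\dots\}$ and let $\mathcal P(\mathcal X)$ be the set of probability distributions on $\mathcal X$. For $P\in\mathcal P(\mathcal X)$ let $P^{\downarrow}$ be its decreasing rearrangement. A function $\phi:\mathcal P(\mathcal X)\to[0,\infty]$ is symmetric if $\phi(P)=\phi(P^\downarrow)$ for all $P$; concave if $\phi(\lambda P+(1-\lambda)P')\ge\lambda\phi(P)+(1-\lambda)\phi(P')$ for all $P,P'$ and $0\le\lambda\le1$; lower semicontinuous if $\liminf_n\phi(P_n)\ge\phi(P)$ whenever $P_n\to P$ pointwise. Its concavity is strict if the concavity inequality is strict whenever $P\ne P'$, $0<\lambda<1$ and $\phi(P),\phi(P')<\infty$. For an $\mathcal X$-valued random variable $X$ and a $\mathcal Y$-valued random variable $Y$ ($\mathcal Y$ a measurable space), let $P_{X|Y}$ be the regular conditional distribution of $X$ given $Y$, put $\mathfrak h_\phi(X\mid Y)=\mathbb E[\phi(P_{X|Y})]$, and let $P_{\mathrm e}^{(L)}(X\mid Y)=\min_f\mathbb P\{X\notin f(Y)\}$, the minimum being over the measurable maps $f$ from $\mathcal Y$ to the nonempty subsets of $\mathcal X$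 with at most $L$ elements. For $Q\in\mathcal P(\mathcal X)$ put $P_{\mathrm e}^{(L)}(Q)=1-\sum_{x=1}^LQ^\downarrow(x)$. Let $Q\in\mathcal P(\mathcal X)$, let $L\ge1$ be an integer, let $\varepsilon$ be real, and let $\mathcal Y$ be a set with $$1-\sum_{x=1}^{\#(\mathcal Y)L}Q^\downarrow(x)\le\varepsilon\le P_{\mathrm e}^{(L)}(Q),$$ where $\#(\mathcal Y)\in\{0,1,\dots,\infty\}$ is the number of elements of $\mathcal Y$. For $j\ge1$ let $\mathcal V(j)=\frac{(1-\varepsilon)-\sum_{x=1}^{j-1}Q^\downarrow(x)}{L-j+1}$ if $j\le L$ and $\mathcal V(j)=1$ if $j>L$. For $L\le k\le\infty$ let $\mathcal W(L)=-1$, $\mathcal W(k)=\frac{\sum_{x=1}^kQ^\downarrow(x)-(1-\varepsilon)}{k-L}$ if $L<k<\infty$, and $\mathcal W(\infty)=0$. Let $J=\min\{j\ge1: Q^\downarrow(j)<\mathcal V(j)\}$ and $K_1=\sup\{L\le k<\infty:\mathcal W(k)<Q^\downarrow(k)\}\in\{L,L+1,\dots,\infty\}$. The type-1 Fano distribution is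 $$P_1(x)=\begin{cases}Q^\downarrow(x)&\text{if }1\le x<J\text{ or }K_1<x<\infty,\\ \mathcal V(J)&\text{if }J\le x\le L,\\ \mathcal W(K_1)&\text{if }L<x\le K_1.\end{cases}$$ Say that $\mathcal Y$ satisfies $\spadesuit$ if $K_1<\infty$ and $|\mathcal Y|\ge\min\{\binom{K_1-J+1}{L-J+1},(K_1-J)^2+1\}$. Then $P_1$ is a probability distribution on $\mathcal X$, and the following holds for every symmetric, concave, lower semicontinuous $\phi:\mathcal P(\mathcal X)\to[0,\infty]$. (a) For every $\sigma$-algebra on $\mathcal Y$, $$\sup_{(X,Y):\,P_{\mathrm e}^{(L)}(X\mid Y)\le\varepsilon,\ P_X=Q}\mathfrak h_\phi(X\mid Y)\le\phi(P_1),\qquad(*)$$ the supremum being over all $\mathcal X\times\mathcal Y$-valued random variables $(X,Y)$ with $P_{\mathrm e}^{(L)}(X\mid Y)\le\varepsilon$ and $P_X=Q$. (b) If $\mathcal Y$ is standard Borel, then $(*)$ holds with equality if any one of the following holds: 1) $\varepsilon=P_{\mathrm e}^{(L)}(Q)$; 2) $\mathcal Y$ satisfies $\spadesuit$ and $0<\varepsilon<P_{\mathrm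 e}^{(L)}(Q)$; 3) $\mathcal Y$ satisfies $\spadesuit$ and $\operatorname{supp}(Q)$ is finite; 4) $J=L$ and $|\mathcal Y|=\aleph_0$. (c) If $|\mathcal Y|\ge\mathfrak c$ (the cardinality of $\mathbb R$), then there is a $\sigma$-algebra on $\mathcal Y$, independent of $\phi$, for which $(*)$ holds with equality. (d) For every $\sigma$-algebra on $\mathcal Y$, if $P_X=Q$ and for every $x\in\mathcal X$ $$P_{X|Y}^\downarrow(x)=P_1(x)\quad\text{a.s.},\qquad(**)$$ then $P_{\mathrm e}^{(L)}(X\mid Y)\le\varepsilon$, equality holds in $(*)$, and $(X,Y)$ achieves the supremum in $(*)$. If moreover the concavity of $\phi$ is strict and $\phi(P_1)<\infty$, then a pair $(X,Y)$ with $P_X=Q$ satisfies $P_{\mathrm e}^{(L)}(X\mid Y)\le\varepsilon$ and achieves equality in $(*)$, i.e. $\mathfrak h_\phi(X\mid Y)=\sup=\phi(P_1)$, if and only if $(**)$ holds for every $x\in\mathcal X$. -/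

import Mathlib

open MeasureTheory ProbabilityTheory Filter
open scoped ENNReal Topology

universe u v

noncomputable section

namespace Fano

/- The alphabet `{1, 2, 3, …}` is modelled by `ℕ`, the symbol `x ≥ 1` being the natural number
`x - 1`.  A probability distribution on the alphabet is a `PMF ℕ`. -/

/-- The `n`-th entry (counting from `0`) of the decreasing rearrangement of `P`: the least level
`t` such that at most `n` symbols have mass exceeding `t`. -/
def rearrFun (P : PMF ℕ) (n : ℕ) : ℝ≥0∞ :=
  sInf {t : ℝ≥0∞ | {x | t < P x}.encard ≤ n}

theorem lt_rearrFun_iff (P : PMF ℕ) (n : ℕ) (t : ℝ≥0∞) :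
    t < rearrFun P n ↔ (n : ℕ∞) < {x | t < P x}.encard := by
  constructor
  · intro h
    by_contra hn
    exact absurd (sInf_le (show t ∈ {t : ℝ≥0∞ | {x | t < P x}.encard ≤ n} from not_lt.1 hn))
      (not_le.2 h)
  · intro h
    have h' : ((n + 1 : ℕ) : ℕ∞) ≤ {x | t < P x}.encard := by
      rw [Nat.cast_add, Nat.cast_one]
      exact Order.add_one_le_of_lt h
    obtain ⟨s, hs, hcard⟩ := Set.exists_subset_encard_eq h'
    have hfin : s.Finite := Set.finite_of_encard_eq_coe hcard
    have hne : s.Nonempty := by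
      rw [Set.nonempty_iff_ne_empty]
      rintro rfl
      simp at hcard
      exact absurd hcard.symm (by positivity)
    obtain ⟨m, hm, hmin⟩ := Set.exists_min_image s P hfin hne
    refine lt_of_lt_of_le (hs hm) (le_sInf fun r hr => ?_)
    by_contra hlt
    have hsub : s ⊆ {x | r < P x} := fun x hx => lt_of_lt_of_le (not_le.1 hlt) (hmin x hx)
    have h1 := (Set.encard_le_encard hsub).trans hr
    rw [hcard] at h1
    have : n + 1 ≤ n := by exact_mod_cast h1
    omega

theorem rearrFun_le_one (P : PMF ℕ) (n : ℕ) : rearrFun P n ≤ 1 := by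
  refine sInf_le ?_
  have : {x | 1 < P x} = ∅ := by
    ext x
    simp [P.coe_le_one x]
  simp [this]

theorem encard_iio (k : ℕ∞) : {n : ℕ | (n : ℕ∞) < k}.encard = k := by
  induction k using ENat.recTopCoe with
  | top => simp
  | coe k =>
    have : {n : ℕ | (n : ℕ∞) < k} = (Finset.range k : Set ℕ) := by
      ext n
      simp
    rw [this, Set.encard_coe_eq_coe_finsetCard, Finset.card_range]

theorem tsum_rearrFun (P : PMF ℕ) : ∑' n, rearrFun P n = 1 := by
  have key : ∀ f : ℕ → ℝ≥0∞, (∀ n, f n ≤ 1) → ∑' n, f n =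
      ∫⁻ t in Set.Ioi (0 : ℝ), Measure.count {n | ENNReal.ofReal t < f n} := by
    intro f hf
    have hfin : ∀ n, f n ≠ ∞ := fun n => ((hf n).trans_lt ENNReal.one_lt_top).ne
    have h := lintegral_eq_lintegral_meas_lt (Measure.count : Measure ℕ)
      (f := fun n => (f n).toReal) (Eventually.of_forall fun n => ENNReal.toReal_nonneg)
      (measurable_of_countable _).aemeasurable
    rw [lintegral_count] at h
    simp only [ENNReal.ofReal_toReal (hfin _)] at h
    rw [h]
    refine setLIntegral_congr_fun measurableSet_Ioi fun t ht => ?_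
    congr 1
    ext n
    exact (ENNReal.ofReal_lt_iff_lt_toReal (le_of_lt ht) (hfin n)).symm
  rw [key _ (rearrFun_le_one P), ← P.tsum_coe, key _ P.coe_le_one]
  refine lintegral_congr fun t => ?_
  simp only [lt_rearrFun_iff]
  rw [Measure.count_apply (MeasurableSet.of_discrete), Measure.count_apply
    (MeasurableSet.of_discrete), encard_iio]

/-- The decreasing rearrangement `P↓` of `P`. -/
def rearr (P : PMF ℕ) : PMF ℕ :=
  ⟨rearrFun P, by rw [← tsum_rearrFun P]; exact ENNReal.summable.hasSum⟩

/-! ### Information measures -/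

/-- `φ(P) = φ(P↓)` for all `P`. -/
def IsSymmetric (φ : PMF ℕ → ℝ≥0∞) : Prop :=
  ∀ P, φ P = φ (rearr P)

/-- Sequential lower semicontinuity for pointwise convergence. -/
def IsLSC (φ : PMF ℕ → ℝ≥0∞) : Prop :=
  ∀ (P : PMF ℕ) (Pn : ℕ → PMF ℕ), (∀ x, Tendsto (fun n => Pn n x) atTop (𝓝 (P x))) →
    φ P ≤ liminf (fun n => φ (Pn n)) atTop

/-- Concavity: `a φ(P) + b φ(P') ≤ φ(a P + b P')` for weights `a + b = 1`. -/
def IsConcave (φ : PMF ℕ → ℝ≥0∞) : Prop :=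
  ∀ (P P' R : PMF ℕ) (a b : ℝ≥0∞), a + b = 1 → (∀ x, R x = a * P x + b * P' x) →
    a * φ P + b * φ P' ≤ φ R

/-- Strictness of the concavity: the inequality is strict if `P ≠ P'`, both weights are positive,
and `φ(P)`, `φ(P')` are finite (it cannot be strict otherwise). -/
def IsStrict (φ : PMF ℕ → ℝ≥0∞) : Prop :=
  ∀ (P P' R : PMF ℕ) (a b : ℝ≥0∞), a + b = 1 → a ≠ 0 → b ≠ 0 → P ≠ P' → φ P ≠ ∞ → φ P' ≠ ∞ →
    (∀ x, R x = a * P x + b * P' x) → a * φ P + b * φ P' < φ R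

/-! ### Random variables -/

section RandomVariables

variable {Ω : Type v} {𝒴 : Type u} [MeasurableSpace Ω] [MeasurableSpace 𝒴]

/-- The regular conditional distribution of `X` given `Y = y`. -/
def condPMF (X : Ω → ℕ) (Y : Ω → 𝒴) (μ : Measure Ω) [IsFiniteMeasure μ] (y : 𝒴) : PMF ℕ :=
  (condDistrib X Y μ y).toPMF

/-- `h_φ(X | Y) = E[φ(P_{X|Y})]`. -/
def condInfo (φ : PMF ℕ → ℝ≥0∞) (X : Ω → ℕ) (Y : Ω → 𝒴) (μ : Measure Ω) [IsFiniteMeasure μ] :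
    ℝ≥0∞ :=
  ∫⁻ ω, φ (condPMF X Y μ (Y ω)) ∂μ

/-- `f` is a (measurable) list decoder with nonempty lists of size at most `L`. -/
def IsListDecoder (L : ℕ) (f : 𝒴 → Finset ℕ) : Prop :=
  (∀ y, 1 ≤ (f y).card ∧ (f y).card ≤ L) ∧ ∀ x, MeasurableSet {y | x ∈ f y}

/-- The minimum average probability of list decoding error with list size `L`. -/
def listError (L : ℕ) (X : Ω → ℕ) (Y : Ω → 𝒴) (μ : Measure Ω) : ℝ≥0∞ :=
  ⨅ (f : 𝒴 → Finset ℕ) (_ : IsListDecoder L f), μ {ω | X ω ∉ f (Y ω)}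

/-- `(X, Y)` is a pair of random variables with `P_X = Q` and list error at most `ε`. -/
def Feasible (Q : PMF ℕ) (L : ℕ) (ε : ℝ) (X : Ω → ℕ) (Y : Ω → 𝒴) (μ : Measure Ω) : Prop :=
  Measurable X ∧ Measurable Y ∧ μ.map X = Q.toMeasure ∧ listError L X Y μ ≤ ENNReal.ofReal ε

end RandomVariables

/-- The supremum of `h_φ(X | Y)` over all feasible pairs of random variables with `Y` valued in
the measurable space `𝒴`. -/
def supInfo (φ : PMF ℕ → ℝ≥0∞) (Q : PMF ℕ) (L : ℕ) (ε : ℝ) (𝒴 : Type u) [MeasurableSpace 𝒴] :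
    ℝ≥0∞ :=
  sSup {h | ∃ (Ω : Type u) (_ : MeasurableSpace Ω) (μ : Measure Ω) (_ : IsProbabilityMeasure μ)
    (X : Ω → ℕ) (Y : Ω → 𝒴), Feasible Q L ε X Y μ ∧ h = condInfo φ X Y μ}

/-! ### The type-1 Fano distribution -/

section Type1

variable (Q : PMF ℕ) (L : ℕ) (ε : ℝ)

/-- `Q↓(j)` as a real number, for a symbol `j ≥ 1`. -/
def q (j : ℕ) : ℝ := (rearr Q (j - 1)).toReal

/-- The list error probability `1 - ∑_{x=1}^{L} Q↓(x)` without side information. -/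
def marginalError : ℝ := 1 - ∑ x ∈ Finset.Icc 1 L, q Q x

/-- The weight `𝒱(j)`, `j ≥ 1`. -/
def V (j : ℕ) : ℝ :=
  if j ≤ L then ((1 - ε) - ∑ x ∈ Finset.Ico 1 j, q Q x) / ((L : ℝ) - j + 1) else 1

/-- The weight `𝒲(k)`, `L ≤ k ≤ ∞`. -/
def W : ℕ∞ → ℝ
  | ⊤ => 0
  | (k : ℕ) => if k = L then -1 else ((∑ x ∈ Finset.Icc 1 k, q Q x) - (1 - ε)) / ((k : ℝ) - L)

/-- `J = min {j ≥ 1 | Q↓(j) < 𝒱(j)}`. -/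
def J : ℕ := sInf {j : ℕ | 1 ≤ j ∧ q Q j < V Q L ε j}

/-- `K₁ = sup {L ≤ k < ∞ | 𝒲(k) < Q↓(k)}`, possibly infinite. -/
def K : ℕ∞ := sSup {k : ℕ∞ | ∃ n : ℕ, k = n ∧ L ≤ n ∧ W Q L ε n < q Q n}

/-- The mass of the type-1 Fano distribution at a symbol `x ≥ 1`. -/
def fanoMass (x : ℕ) : ℝ :=
  if x < J Q L ε ∨ K Q L ε < x then q Q x
  else if x ≤ L then V Q L ε (J Q L ε)
  else W Q L ε (K Q L ε)

/-- `P` is the type-1 Fano distribution built from `(Q, L, ε)`. -/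
def IsFanoType1 (P : PMF ℕ) : Prop :=
  ∀ x : ℕ, 1 ≤ x → (P (x - 1)).toReal = fanoMass Q L ε x

/-- The admissible range of `ε`: `1 - ∑_{x=1}^{#(𝒴) L} Q↓(x) ≤ ε ≤ 1 - ∑_{x=1}^{L} Q↓(x)`. -/
def InRange (𝒴 : Type u) : Prop :=
  1 - (∑' i : ℕ, if ((i + 1 : ℕ) : ℕ∞) ≤ ENat.card 𝒴 * L then q Q (i + 1) else 0) ≤ ε ∧
    ε ≤ marginalError Q L

/-- `K₁` is finite and `|𝒴| ≥ min {binom (K₁ - J + 1) (L - J + 1), (K₁ - J)² + 1}`.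
Here `J ≤ L + 1` and `L ≤ K₁`; if `K₁ < J` then `K₁ = L = J - 1` and the minimum is `1`, so the
truncated subtraction is harmless. -/
def Spade (𝒴 : Type u) : Prop :=
  ∃ k : ℕ, K Q L ε = k ∧
    ((min ((k + 1 - J Q L ε).choose (L + 1 - J Q L ε)) ((k - J Q L ε) ^ 2 + 1) : ℕ) :
      Cardinal.{u}) ≤ Cardinal.mk 𝒴

end Type1

/-- `P_{X|Y}↓(x) = P₁(x)` almost surely, for every symbol `x`. -/
def IsSharp {Ω : Type v} {𝒴 : Type u} [MeasurableSpace Ω] [MeasurableSpace 𝒴] (P₁ : PMF ℕ)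
    (X : Ω → ℕ) (Y : Ω → 𝒴) (μ : Measure Ω) [IsFiniteMeasure μ] : Prop :=
  ∀ x, ∀ᵐ ω ∂μ, rearr (condPMF X Y μ (Y ω)) x = P₁ x

end Fano

end

/-! A symmetric, concave, lower semicontinuous `φ` is Schur-concave: it decreases under
majorization. By Jensen's inequality, applied to the rearranged posterior, `𝔥_φ(X | Y)` is at most
`φ(R)`, where `R` is the mean of `P_{X|Y}↓`. The partial sums of `R` dominate those of `Q↓`, and its
`L` largest masses add up to at least `1 - ε`. Among the decreasing distributions with these
two properties `P₁` is least in the majorization order: it is `Q↓` with the last of the `L` largest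
masses raised to the common level `v = 𝒱(J)` and the following ones cut down to the common level
`w = 𝒲(K₁)`.

The bound is attained because `Q↓` is a mixture of permutations of `P₁`: among the `K₁ - J + 1`
levelled positions it suffices to choose a random set of `L - J + 1` positions that receive the
mass `v`, with prescribed inclusion probabilities. Systematic sampling does this with at most
`K₁ - J + 1` different sets. -/

noncomputable section

namespace Fano

/-! ### The decreasing rearrangement -/

theorem rearr_antitone (P : PMF ℕ) : Antitone (rearr P) := fun m n hmn =>
  le_of_forall_lt fun t ht => (lt_rearrFun_iff P m t).2 <|
    lt_of_le_of_lt (by exact_mod_cast hmn) ((lt_rearrFun_iff P n t).1 ht)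

theorem rearr_congr {P P' : PMF ℕ}
    (h : ∀ t : ℝ≥0∞, {x | t < P x}.encard = {x | t < P' x}.encard) : rearr P = rearr P' := by
  ext n
  change rearrFun P n = rearrFun P' n
  simp only [rearrFun, h]

theorem lt_encard_superlevel_iff {f : ℕ → ℝ≥0∞} (hf : Antitone f) (n : ℕ) (t : ℝ≥0∞) :
    (n : ℕ∞) < {x | t < f x}.encard ↔ t < f n := by
  refine ⟨fun h => ?_, fun h => ?_⟩
  · by_contra hn
    have hsub : {x | t < f x} ⊆ {x : ℕ | (x : ℕ∞) < n} := fun x hx => by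
      by_contra hxn
      exact hn (hx.trans_le (hf (by simpa using hxn)))
    exact h.not_ge ((Set.encard_le_encard hsub).trans_eq (encard_iio n))
  · have hsub : {x : ℕ | (x : ℕ∞) < (n + 1 : ℕ)} ⊆ {x | t < f x} := fun x hx =>
      h.trans_le (hf (Nat.lt_succ_iff.1 (by exact_mod_cast hx)))
    calc (n : ℕ∞) < (n + 1 : ℕ) := by exact_mod_cast Nat.lt_succ_self n
      _ = {x : ℕ | (x : ℕ∞) < (n + 1 : ℕ)}.encard := (encard_iio _).symm
      _ ≤ {x | t < f x}.encard := Set.encard_le_encard hsub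

theorem rearr_eq_self {P : PMF ℕ} (hP : Antitone P) : rearr P = P := by
  ext n
  refine eq_of_forall_lt_iff fun t => ?_
  exact (lt_rearrFun_iff P n t).trans (lt_encard_superlevel_iff hP n t)

theorem rearr_zero_ne_zero (P : PMF ℕ) : rearr P 0 ≠ 0 := fun h =>
  (rearr P).coe_ne_zero (funext fun n => le_zero_iff.1 (h ▸ rearr_antitone P n.zero_le))

/-- The distribution with mass function `f`. -/
def mkPMF {α : Type*} (f : α → ℝ≥0∞) (h : ∑' x, f x = 1) : PMF α :=
  ⟨f, h ▸ ENNReal.summable.hasSum⟩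

@[simp] theorem mkPMF_apply {α : Type*} (f : α → ℝ≥0∞) (h : ∑' x, f x = 1) (x : α) :
    mkPMF f h x = f x := rfl

/-- The distribution `P ∘ σ`, which gives `x` the mass that `P` gives `σ x`. -/
def permute {α : Type*} (σ : Equiv.Perm α) (P : PMF α) : PMF α :=
  mkPMF (P ∘ σ) ((σ.tsum_eq P).trans P.tsum_coe)

@[simp] theorem permute_apply {α : Type*} (σ : Equiv.Perm α) (P : PMF α) (x : α) :
    permute σ P x = P (σ x) := rfl

theorem rearr_permute (σ : Equiv.Perm ℕ) (P : PMF ℕ) : rearr (permute σ P) = rearr P :=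
  rearr_congr fun t => Set.encard_preimage_of_bijective σ.bijective {x | t < P x}

theorem IsSymmetric.permute {φ : PMF ℕ → ℝ≥0∞} (hφ : IsSymmetric φ) (σ : Equiv.Perm ℕ)
    (P : PMF ℕ) : φ (permute σ P) = φ P := by
  rw [hφ, rearr_permute, ← hφ]

/-- The symbols that precede `x` when the symbols are sorted by decreasing mass under `P`, ties
being broken by the order of `ℕ`. -/
def predecessors (P : PMF ℕ) (x : ℕ) : Set ℕ := {y | P x < P y ∨ P y = P x ∧ y < x}

/-- The position of `x`, counted from `0`, when the symbols are sorted by decreasing mass. It is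
meaningful only for `P x ≠ 0`: otherwise `x` may have infinitely many predecessors. -/
def rank (P : PMF ℕ) (x : ℕ) : ℕ := (predecessors P x).ncard

theorem predecessors_subset (P : PMF ℕ) (x : ℕ) : predecessors P x ⊆ {y | P x ≤ P y} := fun _ h =>
  h.elim le_of_lt fun h => h.1.ge

theorem notMem_predecessors_self (P : PMF ℕ) (x : ℕ) : x ∉ predecessors P x := by
  simp [predecessors]

theorem predecessors_finite {P : PMF ℕ} {x : ℕ} (hx : P x ≠ 0) : (predecessors P x).Finite :=
  (ENNReal.finite_const_le_of_tsum_ne_top P.tsum_coe_ne_top hx).subset (predecessors_subset P x)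

theorem coe_rank {P : PMF ℕ} {x : ℕ} (hx : P x ≠ 0) :
    (rank P x : ℕ∞) = (predecessors P x).encard :=
  (predecessors_finite hx).cast_ncard_eq

theorem rank_lt_of_mem_predecessors {P : PMF ℕ} {x y : ℕ} (hx : P x ≠ 0)
    (h : y ∈ predecessors P x) : rank P y < rank P x := by
  refine Set.ncard_lt_ncard ⟨?_, fun hsub => notMem_predecessors_self P y (hsub h)⟩
    (predecessors_finite hx)
  rintro z (hz | hz) <;> rcases h with h | h
  · exact Or.inl (h.trans hz)
  · exact Or.inl (h.1 ▸ hz)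
  · exact Or.inl (hz.1 ▸ h)
  · exact Or.inr ⟨hz.1.trans h.1, hz.2.trans h.2⟩

theorem mem_predecessors_or_mem_predecessors (P : PMF ℕ) {x y : ℕ} (hxy : x ≠ y) :
    x ∈ predecessors P y ∨ y ∈ predecessors P x := by
  rcases lt_trichotomy (P x) (P y) with h | h | h
  · exact Or.inr (Or.inl h)
  · exact hxy.lt_or_gt.imp (fun h' => Or.inr ⟨h, h'⟩) fun h' => Or.inr ⟨h.symm, h'⟩
  · exact Or.inl (Or.inl h)

theorem rank_injOn (P : PMF ℕ) : Set.InjOn (rank P) P.support := by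
  intro x hx y hy hxy
  by_contra hne
  rcases mem_predecessors_or_mem_predecessors P hne with h | h
  · exact (rank_lt_of_mem_predecessors hy h).ne hxy
  · exact (rank_lt_of_mem_predecessors hx h).ne hxy.symm

theorem rearr_rank {P : PMF ℕ} {x : ℕ} (hx : P x ≠ 0) : rearr P (rank P x) = P x := by
  refine le_antisymm (not_lt.1 fun h => ?_) (le_of_forall_lt fun t ht => ?_)
  · have h := (lt_rearrFun_iff P _ _).1 h
    rw [coe_rank hx] at h
    exact h.not_ge (Set.encard_le_encard fun y hy => Or.inl hy)
  · refine (lt_rearrFun_iff P _ _).2 ?_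
    have hsub : insert x (predecessors P x) ⊆ {y | t < P y} :=
      Set.insert_subset ht fun y hy => ht.trans_le (predecessors_subset P x hy)
    calc (rank P x : ℕ∞) < rank P x + 1 := by exact_mod_cast Nat.lt_succ_self _
      _ = (insert x (predecessors P x)).encard := by
        rw [Set.encard_insert_of_notMem (notMem_predecessors_self P x), coe_rank hx]
      _ ≤ _ := Set.encard_le_encard hsub

-- The values of `rearr P` at the ranks already sum to one, so no mass is left elsewhere.
theorem exists_rank_eq {P : PMF ℕ} {n : ℕ} (hn : rearr P n ≠ 0) :
    ∃ x ∈ P.support, rank P x = n := by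
  have hranks : ∑' y : rank P '' P.support, rearr P y = 1 := by
    rw [tsum_image (rearr P) (rank_injOn P), ← P.tsum_coe,
      ← tsum_subtype_eq_of_support_subset (f := P) subset_rfl]
    exact tsum_congr fun x => rearr_rank x.2
  have hsum : 1 + ∑' y : ((rank P '' P.support)ᶜ : Set ℕ), rearr P y = 1 + 0 := by
    rw [add_zero, ← hranks, ENNReal.summable.tsum_add_tsum_compl ENNReal.summable, hranks,
      (rearr P).tsum_coe]
  have hrest := ENNReal.tsum_eq_zero.1 ((ENNReal.add_right_inj ENNReal.one_ne_top).1 hsum)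
  by_contra hcon
  exact hn (hrest ⟨n, hcon⟩)

theorem sum_le_sum_range_card {M : Type*} [AddCommMonoid M] [PartialOrder M]
    [IsOrderedAddMonoid M] {f : ℕ → M} (hf : Antitone f) (s : Finset ℕ) :
    ∑ i ∈ s, f i ≤ ∑ i ∈ Finset.range s.card, f i := by
  induction s using Finset.induction_on_max with
  | empty => simp
  | insert a s ha ih =>
    have hnot : a ∉ s := fun h => lt_irrefl a (ha a h)
    have hcard : s.card ≤ a := by
      simpa using Finset.card_le_card fun x hx => Finset.mem_range.2 (ha x hx)
    rw [Finset.sum_insert hnot, Finset.card_insert_of_notMem hnot, Finset.sum_range_succ, add_comm]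
    exact add_le_add ih (hf hcard)

theorem sum_image_rank {P : PMF ℕ} {s : Finset ℕ} (hs : ∀ x ∈ s, P x ≠ 0) :
    ∑ i ∈ s.image (rank P), rearr P i = ∑ x ∈ s, P x :=
  (Finset.sum_image ((rank_injOn P).mono hs)).trans
    (Finset.sum_congr rfl fun x hx => rearr_rank (hs x hx))

theorem sum_le_sum_rearr (P : PMF ℕ) (s : Finset ℕ) :
    ∑ x ∈ s, P x ≤ ∑ i ∈ Finset.range s.card, rearr P i := by
  set s' := s.filter fun x => P x ≠ 0
  calc ∑ x ∈ s, P x = ∑ x ∈ s', P x := (Finset.sum_filter_ne_zero s).symm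
    _ = ∑ i ∈ s'.image (rank P), rearr P i :=
        (sum_image_rank fun x hx => (Finset.mem_filter.1 hx).2).symm
    _ ≤ ∑ i ∈ Finset.range (s'.image (rank P)).card, rearr P i :=
        sum_le_sum_range_card (rearr_antitone P) _
    _ ≤ ∑ i ∈ Finset.range s.card, rearr P i :=
        Finset.sum_le_sum_of_subset <| Finset.range_subset_range.2 <|
          Finset.card_image_le.trans (Finset.card_filter_le _ _)

theorem finite_rank_lt (P : PMF ℕ) (L : ℕ) : {x | P x ≠ 0 ∧ rank P x < L}.Finite :=
  ((Set.finite_lt_nat L).subset (Set.image_subset_iff.2 fun _ hx => hx.2)).of_finite_image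
    ((rank_injOn P).mono fun _ hx => hx.1)

/-- The list of the `L` most likely symbols, restricted to the support: the optimal decision of a
list decoder with posterior `P`. -/
def topFinset (P : PMF ℕ) (L : ℕ) : Finset ℕ := (finite_rank_lt P L).toFinset

theorem mem_topFinset {P : PMF ℕ} {L x : ℕ} : x ∈ topFinset P L ↔ P x ≠ 0 ∧ rank P x < L := by
  simp [topFinset]

theorem card_topFinset_le (P : PMF ℕ) (L : ℕ) : (topFinset P L).card ≤ L := by
  rw [← Finset.card_range L]
  exact Finset.card_le_card_of_injOn (rank P) (fun x hx => by simpa using (mem_topFinset.1 hx).2)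
    ((rank_injOn P).mono fun x hx => (mem_topFinset.1 hx).1)

theorem one_le_card_topFinset (P : PMF ℕ) {L : ℕ} (hL : 1 ≤ L) : 1 ≤ (topFinset P L).card := by
  obtain ⟨x, hx, hr⟩ := exists_rank_eq (rearr_zero_ne_zero P)
  exact Finset.card_pos.2 ⟨x, mem_topFinset.2 ⟨hx, hr ▸ hL⟩⟩

theorem sum_topFinset (P : PMF ℕ) (L : ℕ) :
    ∑ x ∈ topFinset P L, P x = ∑ i ∈ Finset.range L, rearr P i := by
  rw [← sum_image_rank fun x hx => (mem_topFinset.1 hx).1]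
  refine Finset.sum_subset (Finset.image_subset_iff.2 fun x hx => ?_) fun i hi hni => ?_
  · exact Finset.mem_range.2 (mem_topFinset.1 hx).2
  · by_contra h
    obtain ⟨x, hx, rfl⟩ := exists_rank_eq h
    exact hni (Finset.mem_image_of_mem _ (mem_topFinset.2 ⟨hx, Finset.mem_range.1 hi⟩))

/-! ### Schur concavity -/

theorem eq_of_forall_le {α : Type*} {P R : PMF α} (h : ∀ x, P x ≤ R x) : P = R := by
  by_contra hne
  obtain ⟨x, hx⟩ : ∃ x, P x ≠ R x := by
    by_contra! hall
    exact hne (PMF.ext hall)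
  exact (ENNReal.tsum_lt_tsum P.tsum_coe_ne_top h ((h x).lt_of_ne hx)).ne
    (P.tsum_coe.trans R.tsum_coe.symm)

/-- The convex combination `a P + b P'`. -/
def mix {α : Type*} (a b : ℝ≥0∞) (hab : a + b = 1) (P P' : PMF α) : PMF α :=
  mkPMF (fun x => a * P x + b * P' x) (by
    rw [ENNReal.tsum_add, ENNReal.tsum_mul_left, ENNReal.tsum_mul_left, P.tsum_coe, P'.tsum_coe,
      mul_one, mul_one, hab])

theorem mix_apply {α : Type*} (a b : ℝ≥0∞) (hab : a + b = 1) (P P' : PMF α) (x : α) :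
    mix a b hab P P' x = a * P x + b * P' x := rfl

/-- The partial sums of `R` dominate those of `P`. For decreasing `P` this says that `R` majorizes
`P`, since replacing `R` by its rearrangement only increases its partial sums. -/
def IsMajorizedBy (P R : PMF ℕ) : Prop :=
  ∀ k, ∑ i ∈ Finset.range k, P i ≤ ∑ i ∈ Finset.range k, R i

theorem sum_ne_top (P : PMF ℕ) (s : Finset ℕ) : ∑ i ∈ s, P i ≠ ∞ :=
  ENNReal.sum_ne_top.2 fun i _ => P.apply_ne_top i

theorem sum_range_le_one (P : PMF ℕ) (k : ℕ) : ∑ i ∈ Finset.range k, P i ≤ 1 :=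
  P.tsum_coe ▸ ENNReal.sum_le_tsum _

theorem toReal_sum_range (P : PMF ℕ) (k : ℕ) :
    (∑ i ∈ Finset.range k, P i).toReal = ∑ i ∈ Finset.range k, (P i).toReal :=
  ENNReal.toReal_sum fun i _ => P.apply_ne_top i

theorem isMajorizedBy_iff_toReal {P R : PMF ℕ} : IsMajorizedBy P R ↔
    ∀ k, ∑ i ∈ Finset.range k, (P i).toReal ≤ ∑ i ∈ Finset.range k, (R i).toReal := by
  refine forall_congr' fun k => ?_
  rw [← toReal_sum_range, ← toReal_sum_range,
    ENNReal.toReal_le_toReal (sum_ne_top P _) (sum_ne_top R _)]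

-- The transfer mixes `P` with the distribution obtained from it by swapping `i` and `j`.
theorem exists_transfer {φ : PMF ℕ → ℝ≥0∞} (hs : IsSymmetric φ) (hc : IsConcave φ) (P : PMF ℕ)
    {i j : ℕ} {δ : ℝ} (hδ : 0 < δ) (hle : (P j).toReal + δ ≤ (P i).toReal) :
    ∃ P' : PMF ℕ, φ P ≤ φ P' ∧ (P' i).toReal = (P i).toReal - δ ∧
      (P' j).toReal = (P j).toReal + δ ∧ ∀ x, x ≠ i → x ≠ j → P' x = P x := by
  have hd : 0 < (P i).toReal - (P j).toReal := by linarith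
  obtain ⟨l, hl0, hl1, hlm⟩ : ∃ l : ℝ, 0 ≤ l ∧ l ≤ 1 ∧ l * ((P i).toReal - (P j).toReal) = δ :=
    ⟨δ / ((P i).toReal - (P j).toReal), by positivity, by rw [div_le_one hd]; linarith,
      div_mul_cancel₀ _ hd.ne'⟩
  have hab : ENNReal.ofReal (1 - l) + ENNReal.ofReal l = 1 := by
    rw [← ENNReal.ofReal_add (by linarith) hl0, sub_add_cancel, ENNReal.ofReal_one]
  set P' := mix _ _ hab P (permute (Equiv.swap i j) P) with hP'
  have hreal : ∀ x, (P' x).toReal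
      = (1 - l) * (P x).toReal + l * (P (Equiv.swap i j x)).toReal := fun x => by
    rw [hP', mix_apply, ENNReal.toReal_add
      (ENNReal.mul_ne_top ENNReal.ofReal_ne_top (PMF.apply_ne_top _ _))
      (ENNReal.mul_ne_top ENNReal.ofReal_ne_top (PMF.apply_ne_top _ _)), ENNReal.toReal_mul,
      ENNReal.toReal_mul, ENNReal.toReal_ofReal (by linarith), ENNReal.toReal_ofReal hl0,
      permute_apply]
  refine ⟨P', ?_, ?_, ?_, fun x hxi hxj => ?_⟩
  · have h := hc P (permute (Equiv.swap i j) P) P' _ _ hab (mix_apply _ _ hab P _)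
    rwa [hs.permute, ← add_mul, hab, one_mul] at h
  · rw [hreal, Equiv.swap_apply_left]
    linarith
  · rw [hreal, Equiv.swap_apply_right]
    linarith
  · rw [hP', mix_apply, permute_apply, Equiv.swap_apply_of_ne_of_ne hxi hxj, ← add_mul, hab,
      one_mul]

theorem IsMajorizedBy.exists_lt_of_ne {P R : PMF ℕ} (h : IsMajorizedBy P R) (hne : R ≠ P) :
    ∃ i j, i < j ∧ P i < R i ∧ R j < P j ∧ ∀ x < j, P x ≤ R x := by
  have hdef : ∃ j, R j < P j := by
    by_contra! hall
    exact hne (eq_of_forall_le hall).symm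
  classical
  have hmin : ∀ x < Nat.find hdef, P x ≤ R x := fun x hx => not_lt.1 (Nat.find_min hdef hx)
  suffices ∃ i < Nat.find hdef, P i < R i by
    obtain ⟨i, hij, hi⟩ := this
    exact ⟨i, Nat.find hdef, hij, hi, Nat.find_spec hdef, hmin⟩
  by_contra! hcon
  refine (h (Nat.find hdef + 1)).not_gt ?_
  rw [Finset.sum_range_succ, Finset.sum_range_succ]
  exact ENNReal.add_lt_add_of_le_of_lt (sum_ne_top R _)
    (Finset.sum_le_sum fun x hx => hcon x (Finset.mem_range.1 hx)) (Nat.find_spec hdef)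

theorem IsMajorizedBy.of_transfer {P R R' : PMF ℕ} (h : IsMajorizedBy P R) {i j : ℕ} {δ : ℝ}
    (hij : i < j) (hmin : ∀ x < j, P x ≤ R x) (hδ : δ ≤ (R i).toReal - (P i).toReal)
    (hi : (R' i).toReal = (R i).toReal - δ) (hj : (R' j).toReal = (R j).toReal + δ)
    (hR' : ∀ x, x ≠ i → x ≠ j → R' x = R x) : IsMajorizedBy P R' := by
  rw [isMajorizedBy_iff_toReal] at h ⊢
  intro k
  rcases le_or_gt k j with hk | hk
  · refine Finset.sum_le_sum fun x hx => ?_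
    have hxj : x < j := (Finset.mem_range.1 hx).trans_le hk
    rcases eq_or_ne x i with rfl | hxi
    · linarith
    · rw [hR' x hxi hxj.ne]
      exact ENNReal.toReal_mono (R.apply_ne_top x) (hmin x hxj)
  · refine (h k).trans_eq ?_
    have hdiff : ∀ x, (R' x).toReal
        = (R x).toReal + ((if x = j then δ else 0) - (if x = i then δ else 0)) := by
      intro x
      rcases eq_or_ne x i with rfl | hxi
      · simp [hi, hij.ne, sub_eq_add_neg]
      rcases eq_or_ne x j with rfl | hxj
      · simp [hj, hxi]
      · simp [hR' x hxi hxj, hxi, hxj]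
    simp only [hdiff, Finset.sum_add_distrib, Finset.sum_sub_distrib, Finset.sum_ite_eq',
      Finset.mem_range, hk, hij.trans hk, if_true, sub_self, add_zero]

-- A transfer from an excess of `R` over `P` to the first deficit equalizes one more symbol.
theorem IsMajorizedBy.exists_transfer_ssubset {φ : PMF ℕ → ℝ≥0∞} (hs : IsSymmetric φ)
    (hc : IsConcave φ) {P R : PMF ℕ} (h : IsMajorizedBy P R) (hP : Antitone P) (hne : R ≠ P) :
    ∃ R', IsMajorizedBy P R' ∧ φ R ≤ φ R' ∧ {x | R' x ≠ P x} ⊂ {x | R x ≠ P x} := by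
  obtain ⟨i, j, hij, hPi, hRj, hmin⟩ := h.exists_lt_of_ne hne
  have hi : (P i).toReal < (R i).toReal := ENNReal.toReal_strict_mono (R.apply_ne_top i) hPi
  have hj : (R j).toReal < (P j).toReal := ENNReal.toReal_strict_mono (P.apply_ne_top j) hRj
  have hPij : (P j).toReal ≤ (P i).toReal := ENNReal.toReal_mono (P.apply_ne_top i) (hP hij.le)
  set δ := min ((R i).toReal - (P i).toReal) ((P j).toReal - (R j).toReal) with hδ
  have hδi : δ ≤ (R i).toReal - (P i).toReal := min_le_left _ _
  have hδj : δ ≤ (P j).toReal - (R j).toReal := min_le_right _ _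
  obtain ⟨R', hφ, hi', hj', hx'⟩ := exists_transfer hs hc R (i := i) (j := j) (δ := δ)
    (lt_min (sub_pos.2 hi) (sub_pos.2 hj)) (by linarith)
  have hequal : R' i = P i ∨ R' j = P j := by
    simp only [← ENNReal.toReal_eq_toReal_iff' (PMF.apply_ne_top _ _) (PMF.apply_ne_top _ _),
      hi', hj', hδ]
    exact (min_choice ((R i).toReal - (P i).toReal) ((P j).toReal - (R j).toReal)).imp
      (fun h => by rw [h]; ring) fun h => by rw [h]; ring
  refine ⟨R', h.of_transfer hij hmin hδi hi' hj' hx', hφ, fun x hx => ?_, fun hsub => ?_⟩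
  · rcases eq_or_ne x i with rfl | hxi
    · exact hPi.ne'
    rcases eq_or_ne x j with rfl | hxj
    · exact hRj.ne
    · rwa [Set.mem_ofPred_eq, ← hx' x hxi hxj]
  · exact hequal.elim (hsub hPi.ne') (hsub hRj.ne)

theorem IsMajorizedBy.le_of_finite {φ : PMF ℕ → ℝ≥0∞} (hs : IsSymmetric φ) (hc : IsConcave φ)
    {P R : PMF ℕ} (h : IsMajorizedBy P R) (hP : Antitone P) (hfin : {x | R x ≠ P x}.Finite) :
    φ R ≤ φ P := by
  induction hn : {x | R x ≠ P x}.ncard using Nat.strong_induction_on generalizing R with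
  | _ n ih =>
    rcases eq_or_ne R P with rfl | hne
    · exact le_rfl
    obtain ⟨R', h', hφ, hsub⟩ := h.exists_transfer_ssubset hs hc hP hne
    exact hφ.trans
      (ih _ (hn ▸ Set.ncard_lt_ncard hsub hfin) h' (hfin.subset hsub.subset) rfl)

/-- The mass at `x` of the distribution that agrees with `P` from `m` on and whose partial sums up
to `m` are those of `R`, capped at the partial sum of `P` up to `m`. -/
def cappedMass (P R : PMF ℕ) (m x : ℕ) : ℝ≥0∞ :=
  if x < m then
    min (∑ i ∈ Finset.range (x + 1), R i) (∑ i ∈ Finset.range m, P i)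
      - min (∑ i ∈ Finset.range x, R i) (∑ i ∈ Finset.range m, P i)
  else P x

theorem cappedMass_of_le {P R : PMF ℕ} {m x : ℕ} (h : m ≤ x) : cappedMass P R m x = P x :=
  if_neg h.not_gt

theorem sum_range_tsub_of_monotone {T : ℕ → ℝ≥0∞} (hT : Monotone T) (h0 : T 0 = 0) (k : ℕ) :
    ∑ i ∈ Finset.range k, (T (i + 1) - T i) = T k := by
  induction k with
  | zero => simp [h0]
  | succ k ih => rw [Finset.sum_range_succ, ih, add_tsub_cancel_of_le (hT k.le_succ)]

theorem sum_range_cappedMass {P R : PMF ℕ} {m k : ℕ} (hk : k ≤ m) :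
    ∑ i ∈ Finset.range k, cappedMass P R m i
      = min (∑ i ∈ Finset.range k, R i) (∑ i ∈ Finset.range m, P i) := by
  have hmono : Monotone fun k => min (∑ i ∈ Finset.range k, R i) (∑ i ∈ Finset.range m, P i) :=
    fun a b hab => min_le_min_right _
      (Finset.sum_le_sum_of_subset (Finset.range_subset_range.2 hab))
  rw [← sum_range_tsub_of_monotone hmono (by simp)]
  exact Finset.sum_congr rfl fun i hi => if_pos ((Finset.mem_range.1 hi).trans_le hk)

theorem IsMajorizedBy.sum_range_cappedMass_of_le {P R : PMF ℕ} (h : IsMajorizedBy P R) {m k : ℕ}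
    (hk : m ≤ k) :
    ∑ i ∈ Finset.range k, cappedMass P R m i = ∑ i ∈ Finset.range k, P i := by
  rw [← Finset.sum_range_add_sum_Ico _ hk, ← Finset.sum_range_add_sum_Ico _ hk,
    sum_range_cappedMass le_rfl, min_eq_right (h m)]
  exact congrArg _ (Finset.sum_congr rfl fun i hi => cappedMass_of_le (Finset.mem_Ico.1 hi).1)

theorem IsMajorizedBy.tsum_cappedMass {P R : PMF ℕ} (h : IsMajorizedBy P R) (m : ℕ) :
    ∑' x, cappedMass P R m x = 1 := by
  refine tendsto_nhds_unique (ENNReal.tendsto_nat_tsum _) ?_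
  rw [← P.tsum_coe]
  refine (ENNReal.tendsto_nat_tsum P).congr' ?_
  filter_upwards [eventually_ge_atTop m] with k hk using (h.sum_range_cappedMass_of_le hk).symm

theorem IsMajorizedBy.le_sum_range_cappedMass {P R : PMF ℕ} (h : IsMajorizedBy P R) (m k : ℕ) :
    ∑ i ∈ Finset.range k, P i ≤ ∑ i ∈ Finset.range k, cappedMass P R m i := by
  rcases le_total k m with hk | hk
  · rw [sum_range_cappedMass hk]
    exact le_min (h k) (Finset.sum_le_sum_of_subset (Finset.range_subset_range.2 hk))
  · exact (h.sum_range_cappedMass_of_le hk).ge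

theorem tendsto_cappedMass (P R : PMF ℕ) (x : ℕ) :
    Tendsto (fun m => cappedMass P R m x) atTop (𝓝 (R x)) := by
  have hP : Tendsto (fun m => ∑ i ∈ Finset.range m, P i) atTop (𝓝 1) :=
    P.tsum_coe ▸ ENNReal.tendsto_nat_tsum P
  have hmin : ∀ k, Tendsto (fun m => min (∑ i ∈ Finset.range k, R i) (∑ i ∈ Finset.range m, P i))
      atTop (𝓝 (∑ i ∈ Finset.range k, R i)) := fun k => by
    have h := (tendsto_const_nhds (x := ∑ i ∈ Finset.range k, R i)).min hP
    rwa [min_eq_left (sum_range_le_one R k)] at h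
  have hdiff := ENNReal.Tendsto.sub (hmin (x + 1)) (hmin x) (Or.inl (sum_ne_top R _))
  rw [Finset.sum_range_succ, ENNReal.add_sub_cancel_left (sum_ne_top R _)] at hdiff
  refine hdiff.congr' ?_
  filter_upwards [eventually_gt_atTop x] with m hm
  rw [cappedMass, if_pos hm, Finset.sum_range_succ]

theorem IsMajorizedBy.le {φ : PMF ℕ → ℝ≥0∞} (hs : IsSymmetric φ) (hc : IsConcave φ)
    (hl : IsLSC φ) {P R : PMF ℕ} (h : IsMajorizedBy P R) (hP : Antitone P) : φ R ≤ φ P := by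
  let R' : ℕ → PMF ℕ := fun m => mkPMF (cappedMass P R m) (h.tsum_cappedMass m)
  have hle : ∀ m, φ (R' m) ≤ φ P := fun m =>
    IsMajorizedBy.le_of_finite hs hc (h.le_sum_range_cappedMass m) hP <|
      (Set.finite_lt_nat m).subset fun x hx => not_le.1 fun hmx => hx (cappedMass_of_le hmx)
  calc φ R ≤ liminf (fun m => φ (R' m)) atTop := hl R R' (tendsto_cappedMass P R)
    _ ≤ liminf (fun _ : ℕ => φ P) atTop := liminf_le_liminf (Eventually.of_forall hle)
    _ = φ P := liminf_const _

theorem IsMajorizedBy.eq {φ : PMF ℕ → ℝ≥0∞} (hs : IsSymmetric φ) (hc : IsConcave φ)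
    (hl : IsLSC φ) (hst : IsStrict φ) {P R : PMF ℕ} (h : IsMajorizedBy P R) (hP : Antitone P)
    (hfin : φ P ≠ ∞) (heq : φ P ≤ φ R) : R = P := by
  by_contra hne
  have hle : φ R ≤ φ P := h.le hs hc hl hP
  have hhalf : (2⁻¹ : ℝ≥0∞) + 2⁻¹ = 1 := ENNReal.inv_two_add_inv_two
  have hmid : IsMajorizedBy P (mix _ _ hhalf R P) := fun k => by
    simp only [mix_apply, Finset.sum_add_distrib, ← Finset.mul_sum]
    calc ∑ i ∈ Finset.range k, P i
        = 2⁻¹ * ∑ i ∈ Finset.range k, P i + 2⁻¹ * ∑ i ∈ Finset.range k, P i := by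
          rw [← add_mul, hhalf, one_mul]
      _ ≤ _ := add_le_add (mul_le_mul' le_rfl (h k)) (mul_le_mul' le_rfl le_rfl)
  have hlt : φ P < φ (mix _ _ hhalf R P) := by
    have := hst R P _ _ _ hhalf (by simp) (by simp) hne (hle.trans_lt hfin.lt_top).ne hfin
      (mix_apply _ _ hhalf R P)
    rwa [le_antisymm hle heq, ← add_mul, hhalf, one_mul] at this
  exact hlt.not_ge (hmid.le hs hc hl hP)

/-! ### Jensen's inequality -/

theorem IsConcave.mul_add_mul_le {φ : PMF ℕ → ℝ≥0∞} (hc : IsConcave φ) {P P' R : PMF ℕ}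
    {a b : ℝ≥0∞} (ha : a ≠ ∞) (hb : b ≠ ∞) (h : ∀ x, a * P x + b * P' x = (a + b) * R x) :
    a * φ P + b * φ P' ≤ (a + b) * φ R := by
  rcases eq_or_ne (a + b) 0 with h0 | h0
  · rw [add_eq_zero] at h0
    simp [h0]
  have ht : a + b ≠ ∞ := ENNReal.add_ne_top.2 ⟨ha, hb⟩
  have hinv : (a + b)⁻¹ * (a + b) = 1 := ENNReal.inv_mul_cancel h0 ht
  have hscaled := hc P P' R ((a + b)⁻¹ * a) ((a + b)⁻¹ * b) (by rw [← mul_add, hinv])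
    fun x => by rw [mul_assoc, mul_assoc, ← mul_add, h x, ← mul_assoc, hinv, one_mul]
  rw [mul_assoc, mul_assoc, ← mul_add] at hscaled
  rwa [← ENNReal.inv_mul_le_iff h0 ht]

theorem exists_mul_eq_of_tsum_eq {f : ℕ → ℝ≥0∞} {b : ℝ≥0∞} (hb : b ≠ ∞) (hf : ∑' x, f x = b) :
    ∃ P : PMF ℕ, ∀ x, b * P x = f x := by
  rcases eq_or_ne b 0 with rfl | h0
  · exact ⟨PMF.pure 0, fun x => by rw [zero_mul, ENNReal.tsum_eq_zero.1 hf x]⟩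
  · refine ⟨mkPMF (fun x => b⁻¹ * f x) ?_, fun x => ?_⟩
    · rw [ENNReal.tsum_mul_left, hf, ENNReal.inv_mul_cancel h0 hb]
    · rw [mkPMF_apply, ← mul_assoc, ENNReal.mul_inv_cancel h0 hb, one_mul]

theorem le_of_mul_apply_le {α : Type*} {P R : PMF α} {a b : ℝ≥0∞}
    (h : ∀ x, a * P x ≤ b * R x) : a ≤ b := by
  simpa only [ENNReal.tsum_mul_left, PMF.tsum_coe, mul_one] using ENNReal.tsum_le_tsum h

theorem IsConcave.sum_mul_le {φ : PMF ℕ → ℝ≥0∞} (hc : IsConcave φ) {ι : Type*} (s : Finset ι)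
    (w : ι → ℝ≥0∞) (P : ι → PMF ℕ) {b : ℝ≥0∞} (hb : b ≠ ∞) (R : PMF ℕ)
    (h : ∀ x, ∑ i ∈ s, w i * P i x ≤ b * R x) : ∑ i ∈ s, w i * φ (P i) ≤ b * φ R := by
  classical
  induction s using Finset.induction_on generalizing b R with
  | empty => simp
  | insert i s hi ih =>
    simp only [Finset.sum_insert hi] at h ⊢
    have hle : ∀ x, w i * P i x ≤ b * R x := fun x => le_self_add.trans (h x)
    have hwb : w i ≤ b := le_of_mul_apply_le hle
    have hw : w i ≠ ∞ := ne_top_of_le_ne_top hb hwb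
    have hwP : ∀ x, w i * P i x ≠ ∞ := fun x => ENNReal.mul_ne_top hw ((P i).apply_ne_top x)
    have hrest : ∑' x, (b * R x - w i * P i x) = b - w i := by
      have hsum : ∑' x, w i * P i x = w i := by rw [ENNReal.tsum_mul_left, PMF.tsum_coe, mul_one]
      rw [ENNReal.tsum_sub (hsum.trans_ne hw) hle, hsum, ENNReal.tsum_mul_left, R.tsum_coe, mul_one]
    have hbw : b - w i ≠ ∞ := ENNReal.sub_ne_top hb
    obtain ⟨T, hT⟩ := exists_mul_eq_of_tsum_eq hbw hrest
    calc w i * φ (P i) + ∑ j ∈ s, w j * φ (P j)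
        ≤ w i * φ (P i) + (b - w i) * φ T := by
          gcongr
          exact ih hbw T fun x => hT x ▸ ENNReal.le_sub_of_add_le_left (hwP x) (h x)
      _ ≤ (w i + (b - w i)) * φ R := hc.mul_add_mul_le hw hbw fun x => by
          rw [hT, add_tsub_cancel_of_le (hle x), add_tsub_cancel_of_le hwb]
      _ = b * φ R := by rw [add_tsub_cancel_of_le hwb]

theorem IsConcave.tsum_mul_le {φ : PMF ℕ → ℝ≥0∞} (hc : IsConcave φ) {ι : Type*}
    (w : ι → ℝ≥0∞) (P : ι → PMF ℕ) (R : PMF ℕ) (h : ∀ x, ∑' i, w i * P i x ≤ R x) :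
    ∑' i, w i * φ (P i) ≤ φ R := by
  rw [ENNReal.tsum_eq_iSup_sum]
  refine iSup_le fun s => ?_
  simpa only [one_mul] using hc.sum_mul_le s w P ENNReal.one_ne_top R fun x =>
    (ENNReal.sum_le_tsum s).trans ((h x).trans_eq (one_mul _).symm)

section Barycenter

variable {Ω : Type*} [MeasurableSpace Ω]

/-- The expectation of a random distribution. -/
def barycenter (μ : Measure Ω) [IsProbabilityMeasure μ] (P : Ω → PMF ℕ)
    (hP : ∀ x, Measurable fun ω => P ω x) : PMF ℕ :=
  mkPMF (fun x => ∫⁻ ω, P ω x ∂μ) (by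
    rw [← lintegral_tsum fun x => (hP x).aemeasurable]
    simp only [PMF.tsum_coe, lintegral_one, measure_univ])

theorem barycenter_apply (μ : Measure Ω) [IsProbabilityMeasure μ] (P : Ω → PMF ℕ)
    (hP : ∀ x, Measurable fun ω => P ω x) (x : ℕ) :
    barycenter μ P hP x = ∫⁻ ω, P ω x ∂μ := rfl

/-- The conditional expectation of a random distribution given the event `A`, with an arbitrary
value when `A` is a null set. -/
def condBarycenter (μ : Measure Ω) [IsProbabilityMeasure μ] (P : Ω → PMF ℕ)
    (hP : ∀ x, Measurable fun ω => P ω x) (A : Set Ω) : PMF ℕ :=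
  if h : μ A = 0 then PMF.pure 0 else
    haveI := cond_isProbabilityMeasure h
    barycenter (μ[|A]) P hP

theorem condBarycenter_apply {μ : Measure Ω} [IsProbabilityMeasure μ] {P : Ω → PMF ℕ}
    (hP : ∀ x, Measurable fun ω => P ω x) {A : Set Ω} (hA : μ A ≠ 0) (x : ℕ) :
    condBarycenter μ P hP A x = ∫⁻ ω, P ω x ∂(μ[|A]) := by
  rw [condBarycenter, dif_neg hA, barycenter_apply]

theorem mul_lintegral_cond (μ : Measure Ω) [IsFiniteMeasure μ] (A : Set Ω) (f : Ω → ℝ≥0∞) :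
    μ A * ∫⁻ ω, f ω ∂(μ[|A]) = ∫⁻ ω in A, f ω ∂μ := by
  rw [ProbabilityTheory.cond, ← setLAverage_eq', measure_mul_setLAverage f (measure_ne_top μ A)]

theorem mul_condBarycenter (μ : Measure Ω) [IsProbabilityMeasure μ] (P : Ω → PMF ℕ)
    (hP : ∀ x, Measurable fun ω => P ω x) (A : Set Ω) (x : ℕ) :
    μ A * condBarycenter μ P hP A x = ∫⁻ ω in A, P ω x ∂μ := by
  rcases eq_or_ne (μ A) 0 with h | h
  · rw [h, zero_mul, Measure.restrict_eq_zero.2 h, lintegral_zero_measure]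
  · rw [condBarycenter_apply hP h, mul_lintegral_cond]

theorem barycenter_eq_add_compl (μ : Measure Ω) [IsProbabilityMeasure μ] (P : Ω → PMF ℕ)
    (hP : ∀ x, Measurable fun ω => P ω x) {A : Set Ω} (hA : MeasurableSet A) (x : ℕ) :
    barycenter μ P hP x
      = μ A * condBarycenter μ P hP A x + μ Aᶜ * condBarycenter μ P hP Aᶜ x := by
  rw [mul_condBarycenter, mul_condBarycenter, lintegral_add_compl _ hA, barycenter_apply]

theorem ae_measure_preimage_singleton_ne_zero {β : Type*} [Countable β] (μ : Measure Ω)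
    (f : Ω → β) : ∀ᵐ ω ∂μ, μ (f ⁻¹' {f ω}) ≠ 0 := by
  have hunion : {ω | ¬ μ (f ⁻¹' {f ω}) ≠ 0} = ⋃ b ∈ {b | μ (f ⁻¹' {b}) = 0}, f ⁻¹' {b} := by
    ext ω
    simp
  rw [ae_iff, hunion, measure_biUnion_null_iff (Set.to_countable _)]
  exact fun b hb => hb

theorem IsConcave.lintegral_condBarycenter_fiber_le {φ : PMF ℕ → ℝ≥0∞} (hc : IsConcave φ)
    (μ : Measure Ω) [IsProbabilityMeasure μ] (P : Ω → PMF ℕ) (hP : ∀ x, Measurable fun ω => P ω x)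
    {β : Type*} [Countable β] [MeasurableSpace β] [MeasurableSingletonClass β] {f : Ω → β}
    (hf : Measurable f) :
    ∫⁻ ω, φ (condBarycenter μ P hP (f ⁻¹' {f ω})) ∂μ ≤ φ (barycenter μ P hP) := by
  rw [← lintegral_map (f := fun b => φ (condBarycenter μ P hP (f ⁻¹' {b})))
    (measurable_of_countable _) hf, lintegral_countable']
  simp only [Measure.map_apply hf (measurableSet_singleton _), mul_comm (φ _)]
  refine hc.tsum_mul_le _ _ _ fun x => le_of_eq ?_
  simp only [mul_condBarycenter, barycenter_apply]
  rw [← lintegral_iUnion (fun b => hf (measurableSet_singleton b))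
    (fun b b' h => Set.disjoint_left.2 fun ω h1 h2 => h (h1.symm.trans h2)),
    ← Set.preimage_iUnion, Set.iUnion_of_singleton, Set.preimage_univ, Measure.restrict_univ]

/-- The masses of the first `n` symbols in units of `1 / n`, rounded down. The cells `cell P n = c`
are a countable partition on which each of these masses varies by at most `1 / n`. -/
def cell {Ω : Type*} (P : Ω → PMF ℕ) (n : ℕ) (ω : Ω) : Fin n → ℕ := fun x => ⌊n * (P ω x).toReal⌋₊

theorem measurable_cell {P : Ω → PMF ℕ} (hP : ∀ x, Measurable fun ω => P ω x) (n : ℕ) :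
    Measurable (cell P n) :=
  measurable_pi_lambda _ fun x => Nat.measurable_floor.comp ((hP x).ennreal_toReal.const_mul _)

theorem apply_le_of_cell_eq {Ω : Type*} {P : Ω → PMF ℕ} {n : ℕ} {ω ω' : Ω}
    (h : cell P n ω = cell P n ω') {x : ℕ} (hx : x < n) : P ω x ≤ P ω' x + (n : ℝ≥0∞)⁻¹ := by
  have hn : (0 : ℝ) < n := by exact_mod_cast (Nat.zero_le x).trans_lt hx
  have hscaled : n * (P ω x).toReal ≤ n * ((P ω' x).toReal + (n : ℝ)⁻¹) := by
    calc n * (P ω x).toReal ≤ ⌊n * (P ω x).toReal⌋₊ + 1 := (Nat.lt_floor_add_one _).le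
      _ = ⌊n * (P ω' x).toReal⌋₊ + 1 := by rw [show ⌊_⌋₊ = ⌊_⌋₊ from congrFun h ⟨x, hx⟩]
      _ ≤ n * (P ω' x).toReal + 1 := by
          gcongr
          exact Nat.floor_le (by positivity)
      _ = n * ((P ω' x).toReal + (n : ℝ)⁻¹) := by rw [mul_add, mul_inv_cancel₀ hn.ne']
  have hinv : (n : ℝ≥0∞)⁻¹ ≠ ∞ := ENNReal.inv_ne_top.2 (by exact_mod_cast hn.ne')
  rw [← ENNReal.toReal_le_toReal (PMF.apply_ne_top _ _)
    (ENNReal.add_ne_top.2 ⟨PMF.apply_ne_top _ _, hinv⟩),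
    ENNReal.toReal_add (PMF.apply_ne_top _ _) hinv, ENNReal.toReal_inv, ENNReal.toReal_natCast]
  exact le_of_mul_le_mul_left hscaled hn

theorem lintegral_cond_mem_Icc {μ : Measure Ω} [IsProbabilityMeasure μ] {A : Set Ω}
    (hA : MeasurableSet A) (h0 : μ A ≠ 0) {f : Ω → ℝ≥0∞} {a b : ℝ≥0∞}
    (h : ∀ ω ∈ A, f ω ∈ Set.Icc a b) : ∫⁻ ω, f ω ∂(μ[|A]) ∈ Set.Icc a b := by
  have := cond_isProbabilityMeasure h0
  have hmem : ∀ᵐ ω ∂(μ[|A]), f ω ∈ Set.Icc a b := (ae_cond_mem hA).mono h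
  constructor
  · calc a = ∫⁻ _, a ∂(μ[|A]) := by simp
      _ ≤ _ := lintegral_mono_ae (hmem.mono fun _ => And.left)
  · calc ∫⁻ ω, f ω ∂(μ[|A]) ≤ ∫⁻ _, b ∂(μ[|A]) :=
          lintegral_mono_ae (hmem.mono fun _ => And.right)
      _ = b := by simp

theorem tendsto_condBarycenter_cell {μ : Measure Ω} [IsProbabilityMeasure μ] {P : Ω → PMF ℕ}
    (hP : ∀ x, Measurable fun ω => P ω x) {ω : Ω} (hω : ∀ n, μ (cell P n ⁻¹' {cell P n ω}) ≠ 0)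
    (x : ℕ) :
    Tendsto (fun n => condBarycenter μ P hP (cell P n ⁻¹' {cell P n ω}) x) atTop (𝓝 (P ω x)) := by
  have hinv : Tendsto (fun n : ℕ => (n : ℝ≥0∞)⁻¹) atTop (𝓝 0) :=
    ENNReal.tendsto_inv_nat_nhds_zero
  have hup : Tendsto (fun n : ℕ => P ω x + (n : ℝ≥0∞)⁻¹) atTop (𝓝 (P ω x)) := by
    simpa only [add_zero] using tendsto_const_nhds.add hinv
  have hlow : Tendsto (fun n : ℕ => P ω x - (n : ℝ≥0∞)⁻¹) atTop (𝓝 (P ω x)) := by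
    simpa only [tsub_zero] using
      ENNReal.Tendsto.sub tendsto_const_nhds hinv (Or.inl ((P ω).apply_ne_top x))
  have hmem : ∀ᶠ n : ℕ in atTop, condBarycenter μ P hP (cell P n ⁻¹' {cell P n ω}) x
      ∈ Set.Icc (P ω x - (n : ℝ≥0∞)⁻¹) (P ω x + (n : ℝ≥0∞)⁻¹) := by
    filter_upwards [eventually_gt_atTop x] with n hn
    rw [condBarycenter_apply hP (hω n)]
    exact lintegral_cond_mem_Icc (measurable_cell hP n (measurableSet_singleton _)) (hω n)
      fun ω' hω' => ⟨tsub_le_iff_right.2 (apply_le_of_cell_eq (Eq.symm hω') hn),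
        apply_le_of_cell_eq hω' hn⟩
  exact tendsto_of_tendsto_of_tendsto_of_le_of_le' hlow hup (hmem.mono fun _ => And.left)
    (hmem.mono fun _ => And.right)

theorem IsConcave.lintegral_le {φ : PMF ℕ → ℝ≥0∞} (hc : IsConcave φ) (hl : IsLSC φ)
    (μ : Measure Ω) [IsProbabilityMeasure μ] (P : Ω → PMF ℕ)
    (hP : ∀ x, Measurable fun ω => P ω x) : ∫⁻ ω, φ (P ω) ∂μ ≤ φ (barycenter μ P hP) := by
  have hmeas : ∀ n, Measurable fun ω => φ (condBarycenter μ P hP (cell P n ⁻¹' {cell P n ω})) :=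
    fun n => (measurable_of_countable fun c => φ (condBarycenter μ P hP (cell P n ⁻¹' {c}))).comp
      (measurable_cell hP n)
  calc ∫⁻ ω, φ (P ω) ∂μ
      ≤ ∫⁻ ω, liminf (fun n => φ (condBarycenter μ P hP (cell P n ⁻¹' {cell P n ω}))) atTop ∂μ := by
        refine lintegral_mono_ae ?_
        filter_upwards [ae_all_iff.2 fun n => ae_measure_preimage_singleton_ne_zero μ (cell P n)]
          with ω hω using hl _ _ (tendsto_condBarycenter_cell hP hω)
    _ ≤ liminf (fun n => ∫⁻ ω, φ (condBarycenter μ P hP (cell P n ⁻¹' {cell P n ω})) ∂μ) atTop :=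
        lintegral_liminf_le hmeas
    _ ≤ liminf (fun _ : ℕ => φ (barycenter μ P hP)) atTop :=
        liminf_le_liminf (Eventually.of_forall fun n =>
          hc.lintegral_condBarycenter_fiber_le μ P hP (measurable_cell hP n))
    _ = φ (barycenter μ P hP) := liminf_const _

theorem IsConcave.setLIntegral_le {φ : PMF ℕ → ℝ≥0∞} (hc : IsConcave φ) (hl : IsLSC φ)
    (μ : Measure Ω) [IsProbabilityMeasure μ] (P : Ω → PMF ℕ)
    (hP : ∀ x, Measurable fun ω => P ω x) (A : Set Ω) :
    ∫⁻ ω in A, φ (P ω) ∂μ ≤ μ A * φ (condBarycenter μ P hP A) := by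
  rw [← mul_lintegral_cond]
  rcases eq_or_ne (μ A) 0 with h | h
  · simp only [h, zero_mul, le_refl]
  · have := cond_isProbabilityMeasure h
    rw [condBarycenter, dif_neg h]
    gcongr
    exact hc.lintegral_le hl _ P hP

theorem lt_condBarycenter {μ : Measure Ω} [IsProbabilityMeasure μ] {P : Ω → PMF ℕ}
    (hP : ∀ x, Measurable fun ω => P ω x) {A : Set Ω} (hA : MeasurableSet A) (h0 : μ A ≠ 0)
    {x : ℕ} {c : ℝ≥0∞} (hc : ∀ ω ∈ A, c < P ω x) : c < condBarycenter μ P hP A x := by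
  have := cond_isProbabilityMeasure h0
  obtain ⟨ω, hω⟩ := nonempty_of_measure_ne_zero h0
  rw [condBarycenter_apply hP h0]
  calc c = ∫⁻ _, c ∂(μ[|A]) := by simp
    _ < _ := lintegral_strict_mono (IsProbabilityMeasure.ne_zero _) (hP x).aemeasurable
      (by simpa using (hc ω hω).ne_top) ((ae_cond_mem hA).mono hc)

-- Conditioning on an event over which `P x` exceeds its mean splits the mean into two different
-- distributions, so strict concavity applies unless the event is null.
theorem IsConcave.ae_le_barycenter {φ : PMF ℕ → ℝ≥0∞} (hc : IsConcave φ) (hl : IsLSC φ)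
    (hst : IsStrict φ) (μ : Measure Ω) [IsProbabilityMeasure μ] (P : Ω → PMF ℕ)
    (hP : ∀ x, Measurable fun ω => P ω x) (hfin : φ (barycenter μ P hP) ≠ ∞)
    (heq : φ (barycenter μ P hP) ≤ ∫⁻ ω, φ (P ω) ∂μ) (x : ℕ) :
    ∀ᵐ ω ∂μ, P ω x ≤ barycenter μ P hP x := by
  set R := barycenter μ P hP
  set A : Set Ω := {ω | R x < P ω x}
  have hA : MeasurableSet A := measurableSet_lt measurable_const (hP x)
  have hab : μ A + μ Aᶜ = 1 := prob_add_prob_compl hA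
  have hmix : ∀ z, R z = μ A * condBarycenter μ P hP A z + μ Aᶜ * condBarycenter μ P hP Aᶜ z :=
    barycenter_eq_add_compl μ P hP hA
  suffices hA0 : μ A = 0 by simpa only [ae_iff, not_le] using hA0
  by_contra hA0
  have hlt : R x < condBarycenter μ P hP A x := lt_condBarycenter hP hA hA0 fun _ hω => hω
  have hAc0 : μ Aᶜ ≠ 0 := fun h => hlt.ne <| by
    rw [h, add_zero] at hab
    rw [hmix x, h, hab, one_mul, zero_mul, add_zero]
  have hne : condBarycenter μ P hP A ≠ condBarycenter μ P hP Aᶜ := fun h => hlt.ne <| by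
    rw [hmix x, ← h, ← add_mul, hab, one_mul]
  have hle := hc _ _ _ _ _ hab hmix
  have hfinite := ENNReal.add_ne_top.1 (ne_top_of_le_ne_top hfin hle)
  refine (hst _ _ R _ _ hab hA0 hAc0 hne (fun h => hfinite.1 (h ▸ ENNReal.mul_top hA0))
    (fun h => hfinite.2 (h ▸ ENNReal.mul_top hAc0)) hmix).not_ge ?_
  calc φ R ≤ ∫⁻ ω, φ (P ω) ∂μ := heq
    _ = ∫⁻ ω in A, φ (P ω) ∂μ + ∫⁻ ω in Aᶜ, φ (P ω) ∂μ := (lintegral_add_compl _ hA).symm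
    _ ≤ _ := add_le_add (hc.setLIntegral_le hl μ P hP A) (hc.setLIntegral_le hl μ P hP Aᶜ)

theorem IsConcave.ae_eq_barycenter {φ : PMF ℕ → ℝ≥0∞} (hc : IsConcave φ) (hl : IsLSC φ)
    (hst : IsStrict φ) (μ : Measure Ω) [IsProbabilityMeasure μ] (P : Ω → PMF ℕ)
    (hP : ∀ x, Measurable fun ω => P ω x) (hfin : φ (barycenter μ P hP) ≠ ∞)
    (heq : φ (barycenter μ P hP) ≤ ∫⁻ ω, φ (P ω) ∂μ) (x : ℕ) :
    ∀ᵐ ω ∂μ, P ω x = barycenter μ P hP x := by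
  refine ae_eq_of_ae_le_of_lintegral_le (hc.ae_le_barycenter hl hst μ P hP hfin heq x) ?_
    aemeasurable_const ?_
  · exact (barycenter μ P hP).apply_ne_top x
  · simp [barycenter_apply]

end Barycenter

/-! ### The levels `𝒱(J)` and `𝒲(K₁)` -/

/-- The sum of the `k` largest masses of `Q`. -/
def topSum (Q : PMF ℕ) (k : ℕ) : ℝ := ∑ i ∈ Finset.range k, (rearr Q i).toReal

theorem q_succ (Q : PMF ℕ) (i : ℕ) : q Q (i + 1) = (rearr Q i).toReal := rfl

theorem topSum_succ (Q : PMF ℕ) (k : ℕ) : topSum Q (k + 1) = topSum Q k + (rearr Q k).toReal :=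
  Finset.sum_range_succ _ _

theorem sum_Icc_q (Q : PMF ℕ) (k : ℕ) : ∑ x ∈ Finset.Icc 1 k, q Q x = topSum Q k := by
  induction k with
  | zero => simp [topSum]
  | succ k ih => rw [Finset.sum_Icc_succ_top k.succ_pos, ih, topSum_succ, q_succ]

theorem marginalError_eq (Q : PMF ℕ) (L : ℕ) : marginalError Q L = 1 - topSum Q L := by
  rw [marginalError, sum_Icc_q]

theorem toReal_rearr_antitone (Q : PMF ℕ) : Antitone fun i => (rearr Q i).toReal := fun _ _ h =>
  ENNReal.toReal_mono (PMF.apply_ne_top _ _) (rearr_antitone Q h)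

theorem hasSum_toReal {α : Type*} (P : PMF α) : HasSum (fun i => (P i).toReal) 1 := by
  have h := ENNReal.hasSum_toReal P.tsum_coe_ne_top
  rwa [← ENNReal.tsum_toReal_eq P.apply_ne_top, P.tsum_coe, ENNReal.toReal_one] at h

theorem tendsto_topSum (Q : PMF ℕ) : Tendsto (topSum Q) atTop (𝓝 1) :=
  (hasSum_toReal (rearr Q)).tendsto_sum_nat

theorem topSum_mono (Q : PMF ℕ) : Monotone (topSum Q) := fun _ _ h =>
  Finset.sum_le_sum_of_subset_of_nonneg (Finset.range_subset_range.2 h)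
    fun _ _ _ => ENNReal.toReal_nonneg

theorem topSum_le_one (Q : PMF ℕ) (k : ℕ) : topSum Q k ≤ 1 :=
  (topSum_mono Q).ge_of_tendsto (tendsto_topSum Q) k

section Concavity

variable {r : ℕ → ℝ} {m n k : ℕ}

theorem mul_le_sum_range_sub (hr : Antitone r) (hmn : m ≤ n) (hk : n ≤ k + 1) :
    ((n : ℝ) - m) * r k ≤ ∑ i ∈ Finset.range n, r i - ∑ i ∈ Finset.range m, r i := by
  rw [← Finset.sum_Ico_eq_sub _ hmn]
  have h := Finset.card_nsmul_le_sum (Finset.Ico m n) r (r k) fun i hi =>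
    hr (by have := (Finset.mem_Ico.1 hi).2; omega)
  rwa [Nat.card_Ico, nsmul_eq_mul, Nat.cast_sub hmn] at h

theorem sum_range_sub_le_mul (hr : Antitone r) (hmn : m ≤ n) (hk : k ≤ m) :
    ∑ i ∈ Finset.range n, r i - ∑ i ∈ Finset.range m, r i ≤ ((n : ℝ) - m) * r k := by
  rw [← Finset.sum_Ico_eq_sub _ hmn]
  have h := Finset.sum_le_card_nsmul (Finset.Ico m n) r (r k) fun i hi =>
    hr (by have := (Finset.mem_Ico.1 hi).1; omega)
  rwa [Nat.card_Ico, nsmul_eq_mul, Nat.cast_sub hmn] at h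

-- The partial sums of an antitone sequence are concave, so they lie above their chords.
theorem add_mul_le_sum_range (hr : Antitone r) (hmk : m ≤ k) (hkn : k ≤ n) {a s : ℝ}
    (hm : a ≤ ∑ i ∈ Finset.range m, r i)
    (hn : a + ((n : ℝ) - m) * s ≤ ∑ i ∈ Finset.range n, r i) :
    a + ((k : ℝ) - m) * s ≤ ∑ i ∈ Finset.range k, r i := by
  have hleft := mul_le_sum_range_sub hr hmk k.le_succ
  have hright := sum_range_sub_le_mul hr hkn le_rfl
  have hmk' : (0 : ℝ) ≤ (k : ℝ) - m := sub_nonneg.2 (Nat.cast_le.2 hmk)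
  have hkn' : (0 : ℝ) ≤ (n : ℝ) - k := sub_nonneg.2 (Nat.cast_le.2 hkn)
  rcases le_total s (r k) with hs | hs
  · linarith [mul_le_mul_of_nonneg_left hs hmk']
  · linarith [mul_le_mul_of_nonneg_left hs hkn']

end Concavity

section Parameters

variable {Q : PMF ℕ} {L : ℕ} {ε : ℝ}

theorem sub_mul_V {j : ℕ} (h : j < L) :
    ((L : ℝ) - j) * V Q L ε (j + 1) = 1 - ε - topSum Q j := by
  have hL : (L : ℝ) - j ≠ 0 := sub_ne_zero.2 (by exact_mod_cast h.ne')
  rw [V, if_pos (Nat.succ_le_of_lt h), Finset.Ico_add_one_right_eq_Icc, sum_Icc_q,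
    show (L : ℝ) - (j + 1 : ℕ) + 1 = L - j by push_cast; ring, mul_div_cancel₀ _ hL]

theorem sub_mul_W {k : ℕ} (h : L < k) :
    ((k : ℝ) - L) * W Q L ε k = topSum Q k - (1 - ε) := by
  change _ * (if k = L then -1 else _) = _
  rw [if_neg h.ne', sum_Icc_q, mul_div_cancel₀ _ (sub_ne_zero.2 (by exact_mod_cast h.ne'))]

theorem q_succ_lt_V_iff {j : ℕ} (h : j < L) :
    q Q (j + 1) < V Q L ε (j + 1) ↔ ((L : ℝ) - j) * (rearr Q j).toReal < 1 - ε - topSum Q j := by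
  rw [← sub_mul_V h, mul_lt_mul_iff_right₀ (sub_pos.2 (Nat.cast_lt.2 h)), q_succ]

theorem W_lt_q_succ_iff {k : ℕ} (h : L ≤ k) :
    W Q L ε (k + 1 : ℕ) < q Q (k + 1) ↔
      topSum Q k - (1 - ε) < ((k : ℝ) - L) * (rearr Q k).toReal := by
  have hpos : (0 : ℝ) < (k + 1 : ℕ) - L := sub_pos.2 (Nat.cast_lt.2 (Nat.lt_succ_of_le h))
  rw [← mul_lt_mul_iff_right₀ hpos, sub_mul_W (Nat.lt_succ_of_le h), topSum_succ, q_succ]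
  push_cast
  constructor <;> intro <;> linarith

theorem J_mem (Q : PMF ℕ) {L : ℕ} (hL : 1 ≤ L) (ε : ℝ) :
    1 ≤ J Q L ε ∧ q Q (J Q L ε) < V Q L ε (J Q L ε) := by
  refine Nat.sInf_mem (s := {j : ℕ | 1 ≤ j ∧ q Q j < V Q L ε j}) ⟨L + 1, L.succ_pos, ?_⟩
  have htwo : (2 - 0) * (rearr Q L).toReal ≤ topSum Q 2 - topSum Q 0 := by
    exact_mod_cast mul_le_sum_range_sub (toReal_rearr_antitone Q) (Nat.zero_le 2)
      (Nat.succ_le_succ hL)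
  have hzero : topSum Q 0 = 0 := Finset.sum_range_zero _
  have hone := topSum_le_one Q 2
  rw [q_succ, V, if_neg (Nat.not_succ_le_self L)]
  linarith

theorem exists_J_eq_succ (Q : PMF ℕ) (hL : 1 ≤ L) (ε : ℝ) : ∃ j, J Q L ε = j + 1 :=
  Nat.exists_eq_succ_of_ne_zero (Nat.one_le_iff_ne_zero.1 (J_mem Q hL ε).1)

theorem V_succ_le_of_lt_J {i : ℕ} (h : i + 1 < J Q L ε) : V Q L ε (i + 1) ≤ (rearr Q i).toReal :=
  not_lt.1 fun hlt => Nat.notMem_of_lt_sInf h ⟨i.succ_pos, hlt⟩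

theorem lt_J_of_topSum_eq (hL : 1 ≤ L) (h : topSum Q L = 1 - ε) : L < J Q L ε := by
  obtain ⟨j, hj⟩ := exists_J_eq_succ Q hL ε
  by_contra hcon
  have hjL : j < L := by omega
  have hlt := (J_mem Q hL ε).2
  rw [hj, q_succ_lt_V_iff hjL, ← h] at hlt
  exact hlt.not_ge (sum_range_sub_le_mul (toReal_rearr_antitone Q) hjL.le le_rfl)

theorem J_le_of_topSum_lt (hL : 1 ≤ L) (h : topSum Q L < 1 - ε) : J Q L ε ≤ L := by
  obtain ⟨l, rfl⟩ := Nat.exists_eq_succ_of_ne_zero (Nat.one_le_iff_ne_zero.1 hL)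
  refine Nat.sInf_le ⟨hL, (q_succ_lt_V_iff l.lt_succ_self).2 ?_⟩
  rw [Nat.succ_eq_add_one, topSum_succ] at h
  push_cast
  linarith

theorem V_J_le {j x : ℕ} (hJ : J Q L ε = j + 1) (hjL : j < L) (hx : x < j) :
    V Q L ε (j + 1) ≤ (rearr Q x).toReal := by
  obtain ⟨i, rfl⟩ : ∃ i, j = i + 1 := ⟨j - 1, by omega⟩
  have hi : V Q L ε (i + 1) ≤ (rearr Q i).toReal := V_succ_le_of_lt_J (by omega)
  have hpos : (0 : ℝ) < (L : ℝ) - (i + 1 : ℕ) := sub_pos.2 (Nat.cast_lt.2 hjL)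
  have hpos' : (0 : ℝ) ≤ (L : ℝ) - i := sub_nonneg.2 (Nat.cast_le.2 (by omega))
  refine le_trans ?_ (toReal_rearr_antitone Q (show x ≤ i by omega))
  refine le_of_mul_le_mul_left ?_ hpos
  have hmul := mul_le_mul_of_nonneg_left hi hpos'
  rw [sub_mul_V (by omega)] at hmul
  rw [sub_mul_V hjL, topSum_succ]
  push_cast
  linarith

theorem le_K {n : ℕ} (hn : L ≤ n) (h : W Q L ε n < q Q n) : (n : ℕ∞) ≤ K Q L ε :=
  le_sSup ⟨n, rfl, hn, h⟩

theorem K_le_of_topSum_eq (h : topSum Q L = 1 - ε) : K Q L ε ≤ L := by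
  refine sSup_le ?_
  rintro _ ⟨n, rfl, hn, hW⟩
  by_contra hcon
  have hLn : L < n := by exact_mod_cast not_le.1 hcon
  obtain ⟨i, rfl⟩ : ∃ i, n = i + 1 := ⟨n - 1, by omega⟩
  rw [W_lt_q_succ_iff (by omega), ← h] at hW
  exact hW.not_ge (mul_le_sum_range_sub (toReal_rearr_antitone Q) (by omega) i.le_succ)

theorem lt_K_of_topSum_lt (h : topSum Q L < 1 - ε) : (L : ℕ∞) < K Q L ε := by
  have hW : W Q L ε (L + 1 : ℕ) < q Q (L + 1) := (W_lt_q_succ_iff le_rfl).2 (by linarith)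
  exact lt_of_lt_of_le (by exact_mod_cast L.lt_succ_self) (le_K L.le_succ hW)

theorem W_lt_q_of_K_eq_coe {k : ℕ} (h : K Q L ε = k) (hLk : L < k) : W Q L ε k < q Q k := by
  have hlt : ((k - 1 : ℕ) : ℕ∞) < K Q L ε := by
    rw [h]
    exact_mod_cast Nat.sub_lt (by omega) one_pos
  obtain ⟨_, ⟨n, rfl, hn⟩, hkn⟩ := lt_sSup_iff.1 hlt
  have hle := le_K hn.1 hn.2
  rw [h, Nat.cast_le] at hle
  rw [Nat.cast_lt] at hkn
  obtain rfl : n = k := by omega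
  exact hn.2

theorem rearr_le_W_of_K_eq_coe {k : ℕ} (h : K Q L ε = k) (hLk : L < k) :
    (rearr Q k).toReal ≤ W Q L ε k := by
  have hnot : ¬ W Q L ε (k + 1 : ℕ) < q Q (k + 1) := fun hlt => by
    have hle := le_K (by omega) hlt
    rw [h, Nat.cast_le] at hle
    omega
  rw [W_lt_q_succ_iff hLk.le, not_lt, ← sub_mul_W hLk] at hnot
  exact le_of_mul_le_mul_left hnot (sub_pos.2 (Nat.cast_lt.2 hLk))

theorem frequently_of_K_eq_top (h : K Q L ε = ⊤) :
    ∃ᶠ i in atTop, topSum Q i - (1 - ε) < ((i : ℝ) - L) * (rearr Q i).toReal := by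
  refine frequently_atTop.2 fun N => ?_
  have hlt : ((max N L : ℕ) : ℕ∞) < K Q L ε := h ▸ ENat.natCast_lt_top _
  obtain ⟨_, ⟨n, rfl, -, hW⟩, hn⟩ := lt_sSup_iff.1 hlt
  rw [Nat.cast_lt] at hn
  obtain ⟨i, rfl⟩ : ∃ i, n = i + 1 := ⟨n - 1, by omega⟩
  exact ⟨i, by omega, (W_lt_q_succ_iff (by omega)).1 hW⟩

theorem frequently_lt_of_K_eq_top (h : K Q L ε = ⊤) (N : ℕ) :
    ∃ᶠ i in atTop, topSum Q N - (1 - ε) < ((N : ℝ) - L) * (rearr Q i).toReal := by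
  refine ((frequently_of_K_eq_top h).and_eventually (eventually_ge_atTop N)).mono ?_
  rintro i ⟨hi, hNi⟩
  have hsum := mul_le_sum_range_sub (toReal_rearr_antitone Q) hNi i.le_succ
  rw [topSum] at hi ⊢
  linarith

theorem topSum_le_of_K_eq_top (h : K Q L ε = ⊤) (N : ℕ) : topSum Q N ≤ 1 - ε := by
  have hlim : Tendsto (fun i => ((N : ℝ) - L) * (rearr Q i).toReal) atTop (𝓝 0) := by
    simpa only [mul_zero] using
      (hasSum_toReal (rearr Q)).summable.tendsto_atTop_zero.const_mul ((N : ℝ) - L)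
  exact sub_nonpos.1
    (ge_of_tendsto_of_frequently hlim ((frequently_lt_of_K_eq_top h N).mono fun _ => le_of_lt))

theorem nonpos_of_K_eq_top (h : K Q L ε = ⊤) : ε ≤ 0 := by
  have hle : 1 ≤ 1 - ε := le_of_tendsto' (tendsto_topSum Q) (topSum_le_of_K_eq_top h)
  linarith

theorem topSum_eq_one_of_rearr_eq_zero {x : ℕ} (h : (rearr Q x).toReal = 0) : topSum Q x = 1 := by
  refine ((hasSum_toReal (rearr Q)).unique (hasSum_sum_of_ne_finset_zero fun y hy => ?_)).symm
  exact le_antisymm (h ▸ toReal_rearr_antitone Q (not_lt.1 (mt Finset.mem_range.2 hy)))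
    ENNReal.toReal_nonneg

theorem rearr_pos_of_K_eq_top (hε : 0 ≤ ε) (h : K Q L ε = ⊤) (x : ℕ) :
    0 < (rearr Q x).toReal := by
  by_contra hx
  have hx0 : (rearr Q x).toReal = 0 := le_antisymm (not_lt.1 hx) ENNReal.toReal_nonneg
  obtain ⟨i, hi, hxi⟩ := ((frequently_lt_of_K_eq_top h x).and_eventually
    (eventually_ge_atTop x)).exists
  have hi0 : (rearr Q i).toReal = 0 :=
    le_antisymm (hx0 ▸ toReal_rearr_antitone Q hxi) ENNReal.toReal_nonneg
  rw [topSum_eq_one_of_rearr_eq_zero hx0, hi0, mul_zero] at hi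
  linarith

theorem fanoMass_of_topSum_eq (hL : 1 ≤ L) (h : topSum Q L = 1 - ε) (x : ℕ) :
    fanoMass Q L ε (x + 1) = (rearr Q x).toReal := by
  have hJ := lt_J_of_topSum_eq hL h
  refine if_pos ((lt_or_ge (x + 1) (J Q L ε)).imp_right fun hx => ?_)
  exact (K_le_of_topSum_eq h).trans_lt (Nat.cast_lt.2 (by omega))

end Parameters

theorem nonneg_of_inRange {Q : PMF ℕ} {L : ℕ} {ε : ℝ} {𝒴 : Type u} (h : InRange Q L ε 𝒴) :
    0 ≤ ε := by
  refine le_trans (sub_nonneg.2 ?_) h.1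
  have hs := hasSum_toReal (rearr Q)
  have hnonneg : ∀ i : ℕ, 0 ≤ if ((i + 1 : ℕ) : ℕ∞) ≤ ENat.card 𝒴 * L then q Q (i + 1) else 0 :=
    fun i => ite_nonneg ENNReal.toReal_nonneg le_rfl
  have hle : ∀ i : ℕ, (if ((i + 1 : ℕ) : ℕ∞) ≤ ENat.card 𝒴 * L then q Q (i + 1) else 0)
      ≤ (rearr Q i).toReal := fun i => by
    split_ifs
    exacts [le_rfl, ENNReal.toReal_nonneg]
  exact (Summable.tsum_le_tsum hle (hs.summable.of_nonneg_of_le hnonneg hle) hs.summable).trans_eq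
    hs.tsum_eq

theorem nonempty_of_inRange {Q : PMF ℕ} {L : ℕ} {ε : ℝ} (hL : 1 ≤ L) {𝒴 : Type u}
    (h : InRange Q L ε 𝒴) : Nonempty 𝒴 := by
  by_contra hemp
  rw [not_nonempty_iff] at hemp
  have hε : 1 ≤ ε := by simpa [(ENat.card_eq_zero_iff_empty 𝒴).2 hemp] using h.1
  have hle : ε ≤ 1 - topSum Q L := h.2.trans_eq (marginalError_eq Q L)
  have hmono : topSum Q 1 ≤ topSum Q L := topSum_mono Q hL
  have hpos : 0 < topSum Q 1 := by
    rw [topSum, Finset.sum_range_one]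
    exact ENNReal.toReal_pos (rearr_zero_ne_zero Q) (PMF.apply_ne_top _ _)
  linarith

/-! ### Levelling -/

/-- The mass function obtained from `Q↓` by raising the `L` largest masses to at least `v` and
cutting all others down to at most `w`.  For `v = 𝒱(J)` and `w = 𝒲(K₁)` these are the masses of the
type-1 Fano distribution. -/
def levelledMass (Q : PMF ℕ) (L : ℕ) (v w : ℝ) (x : ℕ) : ℝ :=
  if x < L then max (rearr Q x).toReal v else min (rearr Q x).toReal w

theorem levelledMass_antitone (Q : PMF ℕ) (L : ℕ) (v w : ℝ) : Antitone (levelledMass Q L v w) := by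
  intro x y hxy
  have hQ := toReal_rearr_antitone Q hxy
  rw [levelledMass, levelledMass]
  split_ifs
  · exact max_le_max_right v hQ
  · omega
  · exact (min_le_left _ w).trans (hQ.trans (le_max_left _ v))
  · exact min_le_min_right w hQ

theorem levelledMass_nonneg (Q : PMF ℕ) (L : ℕ) (v : ℝ) {w : ℝ} (hw : 0 ≤ w) (x : ℕ) :
    0 ≤ levelledMass Q L v w x := by
  rw [levelledMass]
  split_ifs
  · exact ENNReal.toReal_nonneg.trans (le_max_left _ v)
  · exact le_min ENNReal.toReal_nonneg hw

/-- The relations that tie `j = J - 1`, `k = K₁`, `v = 𝒱(J)`, `w = 𝒲(K₁)` to `Q` and `c = 1 - ε`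
when the `L` largest masses of `Q` sum to less than `c`: the `i`-th mass of `Q↓` lies below `v`
exactly from `i = j` on and above `w` exactly until `i = k`, and levelling the masses in between
makes the `L` largest ones sum to `c` without changing the total mass. -/
structure IsFanoParams (Q : PMF ℕ) (L : ℕ) (c : ℝ) (j : ℕ) (k : ℕ∞) (v w : ℝ) : Prop where
  j_lt : j < L
  lt_k : (L : ℕ∞) < k
  topSum_add : topSum Q j + ((L : ℝ) - j) * v = c
  v_le : ∀ x < j, v ≤ (rearr Q x).toReal
  lt_v : (rearr Q j).toReal < v
  w_nonneg : 0 ≤ w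
  w_lt : ∀ x : ℕ, (x : ℕ∞) < k → w < (rearr Q x).toReal
  le_w : ∀ x : ℕ, k ≤ x → (rearr Q x).toReal ≤ w
  of_top : k = ⊤ → w = 0 ∧ c = 1
  of_coe : ∀ n : ℕ, k = n → c + ((n : ℝ) - L) * w = topSum Q n

theorem w_lt_of_lt_K {Q : PMF ℕ} {L : ℕ} {ε : ℝ} (hε : 0 ≤ ε) (h : topSum Q L < 1 - ε) {x : ℕ}
    (hx : (x : ℕ∞) < K Q L ε) : W Q L ε (K Q L ε) < (rearr Q x).toReal := by
  have hLK := lt_K_of_topSum_lt h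
  cases hK : K Q L ε using ENat.recTopCoe with
  | top => exact rearr_pos_of_K_eq_top hε hK x
  | coe k =>
    rw [hK, Nat.cast_lt] at hx hLK
    exact (W_lt_q_of_K_eq_coe hK hLK).trans_le (toReal_rearr_antitone Q (by omega))

theorem rearr_le_W_of_K_le {Q : PMF ℕ} {L : ℕ} {ε : ℝ} (h : topSum Q L < 1 - ε) {x : ℕ}
    (hx : K Q L ε ≤ x) : (rearr Q x).toReal ≤ W Q L ε (K Q L ε) := by
  obtain ⟨k, hK⟩ := ENat.ne_top_iff_exists.1 (hx.trans_lt (ENat.natCast_lt_top x)).ne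
  have hLK := lt_K_of_topSum_lt h
  rw [← hK, Nat.cast_le] at hx
  rw [← hK, Nat.cast_lt] at hLK
  rw [← hK]
  exact (toReal_rearr_antitone Q hx).trans (rearr_le_W_of_K_eq_coe hK.symm hLK)

theorem W_K_nonneg {Q : PMF ℕ} {L : ℕ} {ε : ℝ} (h : topSum Q L < 1 - ε) :
    0 ≤ W Q L ε (K Q L ε) := by
  cases hK : K Q L ε using ENat.recTopCoe with
  | top => exact le_rfl
  | coe k => exact hK ▸ ENNReal.toReal_nonneg.trans (rearr_le_W_of_K_le h hK.le)

theorem isFanoParams {Q : PMF ℕ} {L j : ℕ} {ε : ℝ} (hL : 1 ≤ L) (hε : 0 ≤ ε)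
    (h : topSum Q L < 1 - ε) (hJ : J Q L ε = j + 1) :
    IsFanoParams Q L (1 - ε) j (K Q L ε) (V Q L ε (j + 1)) (W Q L ε (K Q L ε)) where
  j_lt := by
    have hJL := J_le_of_topSum_lt hL h
    omega
  lt_k := lt_K_of_topSum_lt h
  topSum_add := by
    rw [sub_mul_V (by have hJL := J_le_of_topSum_lt hL h; omega)]
    ring
  v_le _ hx := V_J_le hJ (by have hJL := J_le_of_topSum_lt hL h; omega) hx
  lt_v := by
    have hlt := (J_mem Q hL ε).2
    rwa [hJ, q_succ] at hlt
  w_nonneg := W_K_nonneg h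
  w_lt _ hx := w_lt_of_lt_K hε h hx
  le_w _ hx := rearr_le_W_of_K_le h hx
  of_top hK := ⟨by rw [hK]; rfl, by linarith only [nonpos_of_K_eq_top hK, hε]⟩
  of_coe n hK := by
    have hLK := lt_K_of_topSum_lt h
    rw [hK, Nat.cast_lt] at hLK
    rw [hK, sub_mul_W hLK]
    ring

theorem sum_range_of_eq_const {f : ℕ → ℝ} {m k : ℕ} {s : ℝ} (hmk : m ≤ k)
    (hf : ∀ i, m ≤ i → i < k → f i = s) :
    ∑ i ∈ Finset.range k, f i = ∑ i ∈ Finset.range m, f i + ((k : ℝ) - m) * s := by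
  rw [← Finset.sum_range_add_sum_Ico f hmk, Finset.sum_congr rfl fun i hi =>
    hf i (Finset.mem_Ico.1 hi).1 (Finset.mem_Ico.1 hi).2, Finset.sum_const, Nat.card_Ico,
    nsmul_eq_mul, Nat.cast_sub hmk]

namespace IsFanoParams

variable {Q : PMF ℕ} {L j : ℕ} {c v w : ℝ} {k : ℕ∞} {n x : ℕ}

theorem levelledMass_of_lt_j (h : IsFanoParams Q L c j k v w) (hx : x < j) :
    levelledMass Q L v w x = (rearr Q x).toReal :=
  (if_pos (hx.trans h.j_lt)).trans (max_eq_left (h.v_le x hx))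

theorem levelledMass_of_lt_L (h : IsFanoParams Q L c j k v w) (hj : j ≤ x) (hx : x < L) :
    levelledMass Q L v w x = v :=
  (if_pos hx).trans (max_eq_right ((toReal_rearr_antitone Q hj).trans h.lt_v.le))

theorem levelledMass_of_lt_k (h : IsFanoParams Q L c j k v w) (hL : L ≤ x) (hx : (x : ℕ∞) < k) :
    levelledMass Q L v w x = w :=
  (if_neg hL.not_gt).trans (min_eq_right (h.w_lt x hx).le)

theorem levelledMass_of_k_le (h : IsFanoParams Q L c j k v w) (hx : k ≤ x) :
    levelledMass Q L v w x = (rearr Q x).toReal :=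
  (if_neg (Nat.cast_lt.1 (h.lt_k.trans_le hx)).not_gt).trans (min_eq_left (h.le_w x hx))

theorem sum_of_le_j (h : IsFanoParams Q L c j k v w) (hn : n ≤ j) :
    ∑ i ∈ Finset.range n, levelledMass Q L v w i = topSum Q n :=
  Finset.sum_congr rfl fun _ hi => h.levelledMass_of_lt_j ((Finset.mem_range.1 hi).trans_le hn)

theorem sum_of_le_L (h : IsFanoParams Q L c j k v w) (hj : j ≤ n) (hn : n ≤ L) :
    ∑ i ∈ Finset.range n, levelledMass Q L v w i = topSum Q j + ((n : ℝ) - j) * v := by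
  rw [sum_range_of_eq_const hj fun i hji hin => h.levelledMass_of_lt_L hji (hin.trans_le hn),
    h.sum_of_le_j le_rfl]

theorem sum_L (h : IsFanoParams Q L c j k v w) :
    ∑ i ∈ Finset.range L, levelledMass Q L v w i = c :=
  (h.sum_of_le_L h.j_lt.le le_rfl).trans h.topSum_add

theorem sum_of_le_k (h : IsFanoParams Q L c j k v w) (hL : L ≤ n) (hn : (n : ℕ∞) ≤ k) :
    ∑ i ∈ Finset.range n, levelledMass Q L v w i = c + ((n : ℝ) - L) * w := by
  rw [sum_range_of_eq_const hL fun i hLi hin =>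
    h.levelledMass_of_lt_k hLi ((Nat.cast_lt.2 hin).trans_le hn), h.sum_L]

theorem sum_of_k_le (h : IsFanoParams Q L c j k v w) (hn : k ≤ n) :
    ∑ i ∈ Finset.range n, levelledMass Q L v w i = topSum Q n := by
  obtain ⟨m, rfl⟩ := ENat.ne_top_iff_exists.1 (hn.trans_lt (ENat.natCast_lt_top n)).ne
  have hmn : m ≤ n := Nat.cast_le.1 hn
  have hLm : L < m := Nat.cast_lt.1 h.lt_k
  have htail : ∑ i ∈ Finset.Ico m n, levelledMass Q L v w i =
      ∑ i ∈ Finset.Ico m n, (rearr Q i).toReal := Finset.sum_congr rfl fun i hi =>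
    h.levelledMass_of_k_le (Nat.cast_le.2 (Finset.mem_Ico.1 hi).1)
  rw [← Finset.sum_range_add_sum_Ico _ hmn, h.sum_of_le_k hLm.le le_rfl, h.of_coe m rfl, htail]
  exact Finset.sum_range_add_sum_Ico _ hmn

theorem hasSum_levelledMass (h : IsFanoParams Q L c j k v w) :
    HasSum (levelledMass Q L v w) 1 := by
  rw [hasSum_iff_tendsto_nat_of_nonneg (levelledMass_nonneg Q L v h.w_nonneg)]
  cases k using ENat.recTopCoe with
  | top =>
    refine tendsto_const_nhds.congr' ?_
    filter_upwards [eventually_ge_atTop L] with n hn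
    rw [h.sum_of_le_k hn le_top, (h.of_top rfl).1, (h.of_top rfl).2, mul_zero, add_zero]
  | coe m =>
    refine (tendsto_topSum Q).congr' ?_
    filter_upwards [eventually_ge_atTop m] with n hn
    rw [h.sum_of_k_le (Nat.cast_le.2 hn)]

/-- The levelled mass function as a distribution. -/
def toPMF (h : IsFanoParams Q L c j k v w) : PMF ℕ :=
  mkPMF (fun x => ENNReal.ofReal (levelledMass Q L v w x)) (by
    rw [← ENNReal.ofReal_tsum_of_nonneg (levelledMass_nonneg Q L v h.w_nonneg)
      h.hasSum_levelledMass.summable, h.hasSum_levelledMass.tsum_eq, ENNReal.ofReal_one])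

theorem toReal_toPMF (h : IsFanoParams Q L c j k v w) (x : ℕ) :
    (h.toPMF x).toReal = levelledMass Q L v w x :=
  ENNReal.toReal_ofReal (levelledMass_nonneg Q L v h.w_nonneg x)

theorem toPMF_antitone (h : IsFanoParams Q L c j k v w) : Antitone h.toPMF := fun _ _ hxy =>
  ENNReal.ofReal_le_ofReal (levelledMass_antitone Q L v w hxy)

theorem sum_levelledMass_le (h : IsFanoParams Q L c j k v w) {r : ℕ → ℝ} (hr : Antitone r)
    (hr0 : ∀ i, 0 ≤ r i) (hQ : ∀ n, topSum Q n ≤ ∑ i ∈ Finset.range n, r i)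
    (hc : c ≤ ∑ i ∈ Finset.range L, r i) (n : ℕ) :
    ∑ i ∈ Finset.range n, levelledMass Q L v w i ≤ ∑ i ∈ Finset.range n, r i := by
  rcases le_total n j with hnj | hjn
  · exact (h.sum_of_le_j hnj).trans_le (hQ n)
  rcases le_total n L with hnL | hLn
  · rw [h.sum_of_le_L hjn hnL]
    exact add_mul_le_sum_range hr hjn hnL (hQ j) (h.topSum_add.trans_le hc)
  rcases le_total (n : ℕ∞) k with hnk | hkn
  · rw [h.sum_of_le_k hLn hnk]
    cases k using ENat.recTopCoe with
    | top =>
      rw [(h.of_top rfl).1, mul_zero, add_zero]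
      exact hc.trans (Finset.sum_le_sum_of_subset_of_nonneg (Finset.range_subset_range.2 hLn)
        fun i _ _ => hr0 i)
    | coe m =>
      exact add_mul_le_sum_range hr hLn (Nat.cast_le.1 hnk) hc ((h.of_coe m rfl).trans_le (hQ m))
  · exact (h.sum_of_k_le hkn).trans_le (hQ n)

theorem fanoMass_eq_levelledMass {ε : ℝ} (hJ : J Q L ε = j + 1)
    (h : IsFanoParams Q L c j (K Q L ε) (V Q L ε (j + 1)) (W Q L ε (K Q L ε))) (x : ℕ) :
    fanoMass Q L ε (x + 1) = levelledMass Q L (V Q L ε (j + 1)) (W Q L ε (K Q L ε)) x := by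
  have hK : K Q L ε < (x + 1 : ℕ) ↔ K Q L ε ≤ x := by
    rw [Nat.cast_succ, ENat.lt_add_one_iff (ENat.natCast_ne_top x)]
  rw [fanoMass, hJ, q_succ]
  split_ifs with hx hL
  · rcases hx with hx | hx
    · exact (h.levelledMass_of_lt_j (by omega)).symm
    · exact (h.levelledMass_of_k_le (hK.1 hx)).symm
  · rw [h.levelledMass_of_lt_L (by omega) (by omega)]
  · rw [h.levelledMass_of_lt_k (by omega) (not_le.1 fun hkx => hx (.inr (hK.2 hkx)))]

end IsFanoParams

/-- The optimality of the type-1 Fano distribution among the nonincreasing distributions that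
majorize `Q` and whose `L` largest masses sum to at least `1 - ε`: it is the least of them with
respect to majorization. -/
structure IsExtremal (Q : PMF ℕ) (L : ℕ) (ε : ℝ) (P₁ : PMF ℕ) : Prop where
  antitone : Antitone P₁
  sum_eq : ∑ i ∈ Finset.range L, P₁ i = ENNReal.ofReal (1 - ε)
  isMajorizedBy : ∀ R : PMF ℕ, Antitone R → IsMajorizedBy (rearr Q) R →
    ENNReal.ofReal (1 - ε) ≤ ∑ i ∈ Finset.range L, R i → IsMajorizedBy P₁ R

theorem ofReal_sum_toReal (P : PMF ℕ) (k : ℕ) :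
    ENNReal.ofReal (∑ i ∈ Finset.range k, (P i).toReal) = ∑ i ∈ Finset.range k, P i := by
  rw [← toReal_sum_range, ENNReal.ofReal_toReal (sum_ne_top P _)]

theorem isExtremal_rearr {Q : PMF ℕ} {L : ℕ} {ε : ℝ} (h : topSum Q L = 1 - ε) :
    IsExtremal Q L ε (rearr Q) where
  antitone := rearr_antitone Q
  sum_eq := by rw [← h, topSum, ofReal_sum_toReal]
  isMajorizedBy := fun _ _ hR _ => hR

theorem IsFanoParams.isExtremal {Q : PMF ℕ} {L j : ℕ} {ε v w : ℝ} {k : ℕ∞}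
    (h : IsFanoParams Q L (1 - ε) j k v w) : IsExtremal Q L ε h.toPMF where
  antitone := h.toPMF_antitone
  sum_eq := by
    rw [← ofReal_sum_toReal]
    simp only [h.toReal_toPMF]
    rw [h.sum_L]
  isMajorizedBy R hR hQ hL := by
    rw [isMajorizedBy_iff_toReal] at hQ ⊢
    simp only [h.toReal_toPMF]
    refine h.sum_levelledMass_le (fun x y hxy => ENNReal.toReal_mono (R.apply_ne_top x) (hR hxy))
      (fun _ => ENNReal.toReal_nonneg) hQ ?_
    rw [← toReal_sum_range]
    exact (ENNReal.ofReal_le_iff_le_toReal (sum_ne_top R _)).1 hL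

theorem isFanoType1_of_forall {Q : PMF ℕ} {L : ℕ} {ε : ℝ} {P : PMF ℕ}
    (h : ∀ x, fanoMass Q L ε (x + 1) = (P x).toReal) : IsFanoType1 Q L ε P := by
  intro x hx
  obtain ⟨y, rfl⟩ := Nat.exists_eq_succ_of_ne_zero (Nat.one_le_iff_ne_zero.1 hx)
  exact (h y).symm

theorem exists_isFanoType1 {Q : PMF ℕ} {L : ℕ} {ε : ℝ} (hL : 1 ≤ L) (h0 : 0 ≤ ε)
    (h1 : ε ≤ marginalError Q L) :
    ∃ P₁ : PMF ℕ, IsFanoType1 Q L ε P₁ ∧ IsExtremal Q L ε P₁ ∧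
      (P₁ = rearr Q ∨ ε < marginalError Q L ∧ ∃ (v w : ℝ)
        (h : IsFanoParams Q L (1 - ε) (J Q L ε - 1) (K Q L ε) v w), P₁ = h.toPMF) := by
  rw [marginalError_eq] at h1 ⊢
  rcases eq_or_lt_of_le (le_sub_comm.1 h1) with h | h
  · exact ⟨rearr Q, isFanoType1_of_forall (fanoMass_of_topSum_eq hL h), isExtremal_rearr h,
      .inl rfl⟩
  · obtain ⟨j, hJ⟩ := exists_J_eq_succ Q hL ε
    have hpar := isFanoParams hL h0 h hJ
    rw [hJ, Nat.add_sub_cancel]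
    refine ⟨hpar.toPMF, isFanoType1_of_forall fun x => ?_, hpar.isExtremal,
      .inr ⟨lt_sub_comm.1 h, _, _, hpar, rfl⟩⟩
    rw [hpar.toReal_toPMF, hpar.fanoMass_eq_levelledMass hJ]

/-! ### Conditional distributions and list decoding -/

section Measurability

variable {Ω : Type*} [MeasurableSpace Ω]

theorem measurableSet_le_encard {E : Ω → Set ℕ} (hE : ∀ x, MeasurableSet {ω | x ∈ E ω}) (n : ℕ) :
    MeasurableSet {ω | (n : ℕ∞) ≤ (E ω).encard} := by
  have hset : {ω | (n : ℕ∞) ≤ (E ω).encard}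
      = ⋃ s : {s : Finset ℕ // s.card = n}, ⋂ x : {x // x ∈ s.1}, {ω | (x : ℕ) ∈ E ω} := by
    ext ω
    simp only [Set.mem_ofPred_eq, Set.mem_iUnion, Set.mem_iInter]
    constructor
    · intro h
      obtain ⟨s, hs, hcard⟩ := Set.exists_subset_encard_eq h
      have hfin : s.Finite := Set.finite_of_encard_eq_coe hcard
      rw [hfin.encard_eq_coe_toFinset_card, Nat.cast_inj] at hcard
      exact ⟨⟨hfin.toFinset, hcard⟩, fun x => hs (hfin.mem_toFinset.1 x.2)⟩
    · rintro ⟨⟨s, hs⟩, h⟩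
      rw [← hs, ← Set.encard_coe_eq_coe_finsetCard]
      exact Set.encard_le_encard fun x hx => h ⟨x, hx⟩
  rw [hset]
  exact MeasurableSet.iUnion fun s => MeasurableSet.iInter fun x => hE x

theorem measurable_rearr {P : Ω → PMF ℕ} (hP : ∀ x, Measurable fun ω => P ω x) (n : ℕ) :
    Measurable fun ω => rearr (P ω) n := by
  refine measurable_of_Ioi fun t => ?_
  have hset : (fun ω => rearr (P ω) n) ⁻¹' Set.Ioi t
      = {ω | ((n + 1 : ℕ) : ℕ∞) ≤ {x | t < P ω x}.encard} := by
    ext ω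
    refine (lt_rearrFun_iff (P ω) n t).trans ?_
    rw [Set.mem_ofPred_eq, Nat.cast_succ, ENat.add_one_le_iff (ENat.natCast_ne_top n)]
  rw [hset]
  exact measurableSet_le_encard (fun x => measurableSet_lt measurable_const (hP x)) _

theorem measurableSet_mem_topFinset {P : Ω → PMF ℕ} (hP : ∀ x, Measurable fun ω => P ω x)
    (L x : ℕ) : MeasurableSet {ω | x ∈ topFinset (P ω) L} := by
  have hset : {ω | x ∈ topFinset (P ω) L}
      = {ω | P ω x = 0}ᶜ ∩ {ω | (L : ℕ∞) ≤ (predecessors (P ω) x).encard}ᶜ := by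
    ext ω
    refine mem_topFinset.trans (and_congr_right fun hx => ?_)
    rw [Set.mem_compl_iff, Set.mem_ofPred_eq, not_le, ← coe_rank hx, Nat.cast_lt]
  rw [hset]
  refine (measurableSet_eq_fun (hP x) measurable_const).compl.inter
    (measurableSet_le_encard (fun y => ?_) L).compl
  exact (measurableSet_lt (hP x) (hP y)).union
    ((measurableSet_eq_fun (hP y) (hP x)).inter (MeasurableSet.const _))

end Measurability

section RandomVariables

variable {Ω : Type v} {𝒴 : Type u} [MeasurableSpace Ω] [MeasurableSpace 𝒴]

theorem condPMF_apply (X : Ω → ℕ) (Y : Ω → 𝒴) (μ : Measure Ω) [IsFiniteMeasure μ] (y : 𝒴) (x : ℕ) :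
    condPMF X Y μ y x = condDistrib X Y μ y {x} := by
  rw [condPMF, Measure.toPMF_apply]

theorem measurable_condPMF (X : Ω → ℕ) (Y : Ω → 𝒴) (μ : Measure Ω) [IsFiniteMeasure μ] (x : ℕ) :
    Measurable fun y => condPMF X Y μ y x := by
  simp only [condPMF_apply]
  exact Kernel.measurable_coe _ (measurableSet_singleton x)

theorem measurable_rearr_condPMF (X : Ω → ℕ) {Y : Ω → 𝒴} (μ : Measure Ω) [IsFiniteMeasure μ]
    (hY : Measurable Y) (n : ℕ) : Measurable fun ω => rearr (condPMF X Y μ (Y ω)) n :=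
  measurable_rearr (fun x => (measurable_condPMF X Y μ x).comp hY) n

theorem measurableSet_graph {f : 𝒴 → Finset ℕ} (hf : ∀ x, MeasurableSet {y | x ∈ f y}) :
    MeasurableSet {p : 𝒴 × ℕ | p.2 ∈ f p.1} := by
  have hset : {p : 𝒴 × ℕ | p.2 ∈ f p.1} = ⋃ x, {y | x ∈ f y} ×ˢ {x} := by
    ext p
    simp
  rw [hset]
  exact MeasurableSet.iUnion fun x => (hf x).prod (measurableSet_singleton x)

section Lists

variable {X : Ω → ℕ} {Y : Ω → 𝒴} {μ : Measure Ω} {f : 𝒴 → Finset ℕ}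

theorem measure_mem_list [IsFiniteMeasure μ] (hX : Measurable X) (hY : Measurable Y)
    (hf : ∀ x, MeasurableSet {y | x ∈ f y}) :
    μ {ω | X ω ∈ f (Y ω)} = ∫⁻ ω, ∑ x ∈ f (Y ω), condPMF X Y μ (Y ω) x ∂μ := by
  have hgraph := measurableSet_graph hf
  have hsum : ∀ y, condDistrib X Y μ y (Prod.mk y ⁻¹' {p : 𝒴 × ℕ | p.2 ∈ f p.1})
      = ∑ x ∈ f y, condPMF X Y μ y x := fun y => by
    simp only [condPMF_apply, sum_measure_singleton]
    rfl
  calc μ {ω | X ω ∈ f (Y ω)}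
      = (μ.map fun ω => (Y ω, X ω)) {p | p.2 ∈ f p.1} :=
        (Measure.map_apply (hY.prodMk hX) hgraph).symm
    _ = ∫⁻ y, condDistrib X Y μ y (Prod.mk y ⁻¹' {p | p.2 ∈ f p.1}) ∂(μ.map Y) := by
        rw [← compProd_map_condDistrib hX.aemeasurable, Measure.compProd_apply hgraph]
    _ = ∫⁻ ω, condDistrib X Y μ (Y ω) (Prod.mk (Y ω) ⁻¹' {p | p.2 ∈ f p.1}) ∂μ :=
        lintegral_map (Kernel.measurable_kernel_prodMk_left hgraph) hY
    _ = ∫⁻ ω, ∑ x ∈ f (Y ω), condPMF X Y μ (Y ω) x ∂μ := by simp only [hsum]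

theorem measure_notMem_list [IsProbabilityMeasure μ] (hX : Measurable X) (hY : Measurable Y)
    (hf : ∀ x, MeasurableSet {y | x ∈ f y}) :
    μ {ω | X ω ∉ f (Y ω)} = 1 - μ {ω | X ω ∈ f (Y ω)} :=
  prob_compl_eq_one_sub (hY.prodMk hX (measurableSet_graph hf))

/-- The mean `E[P_{X|Y}↓]` of the rearranged conditional distributions, to which Jensen's inequality
reduces the conditional information. -/
def meanRearr (X : Ω → ℕ) (Y : Ω → 𝒴) (μ : Measure Ω) [IsProbabilityMeasure μ]
    (hY : Measurable Y) : PMF ℕ :=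
  barycenter μ (fun ω => rearr (condPMF X Y μ (Y ω))) (measurable_rearr_condPMF X μ hY)

theorem sum_meanRearr [IsProbabilityMeasure μ] (hY : Measurable Y) (k : ℕ) :
    ∑ i ∈ Finset.range k, meanRearr X Y μ hY i
      = ∫⁻ ω, ∑ i ∈ Finset.range k, rearr (condPMF X Y μ (Y ω)) i ∂μ :=
  (lintegral_finsetSum _ fun n _ => measurable_rearr_condPMF X μ hY n).symm

theorem meanRearr_antitone [IsProbabilityMeasure μ] (hY : Measurable Y) :
    Antitone (meanRearr X Y μ hY) := fun _ _ h =>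
  lintegral_mono fun ω => rearr_antitone (condPMF X Y μ (Y ω)) h

theorem measure_mem_list_le [IsProbabilityMeasure μ] (hX : Measurable X) (hY : Measurable Y) {k : ℕ}
    (hf : ∀ x, MeasurableSet {y | x ∈ f y}) (hk : ∀ y, (f y).card ≤ k) :
    μ {ω | X ω ∈ f (Y ω)} ≤ ∑ i ∈ Finset.range k, meanRearr X Y μ hY i := by
  rw [measure_mem_list hX hY hf, sum_meanRearr]
  exact lintegral_mono fun ω => (sum_le_sum_rearr _ _).trans
    (Finset.sum_le_sum_of_subset (Finset.range_subset_range.2 (hk _)))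

-- A list of the `k` most likely symbols of `Q` is a decoder that ignores `Y`.
theorem isMajorizedBy_meanRearr [IsProbabilityMeasure μ] (hX : Measurable X) (hY : Measurable Y)
    {Q : PMF ℕ} (hQ : μ.map X = Q.toMeasure) : IsMajorizedBy (rearr Q) (meanRearr X Y μ hY) := by
  intro k
  rw [← sum_topFinset, ← Q.toMeasure_apply_finset, ← hQ,
    Measure.map_apply hX (Finset.measurableSet _)]
  exact measure_mem_list_le hX hY (f := fun _ => topFinset Q k) (fun _ => MeasurableSet.const _)
    fun _ => card_topFinset_le Q k

theorem one_sub_le_sum_meanRearr [IsProbabilityMeasure μ] (hX : Measurable X) (hY : Measurable Y)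
    {L : ℕ} {ε : ℝ} (hε : 0 ≤ ε) (h : listError L X Y μ ≤ ENNReal.ofReal ε) :
    ENNReal.ofReal (1 - ε) ≤ ∑ i ∈ Finset.range L, meanRearr X Y μ hY i := by
  rw [ENNReal.ofReal_sub _ hε, ENNReal.ofReal_one, tsub_le_iff_tsub_le]
  refine (le_iInf₂ fun f hf => ?_).trans h
  rw [measure_notMem_list hX hY hf.2]
  exact tsub_le_tsub_left (measure_mem_list_le hX hY hf.2 fun y => (hf.1 y).2) _

theorem listError_le [IsProbabilityMeasure μ] (hX : Measurable X) (hY : Measurable Y) {L : ℕ}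
    (hL : 1 ≤ L) : listError L X Y μ ≤ 1 - ∑ i ∈ Finset.range L, meanRearr X Y μ hY i := by
  have hf : ∀ x, MeasurableSet {y | x ∈ topFinset (condPMF X Y μ y) L} :=
    measurableSet_mem_topFinset (measurable_condPMF X Y μ) L
  refine (iInf₂_le (fun y => topFinset (condPMF X Y μ y) L) ⟨fun y =>
    ⟨one_le_card_topFinset _ hL, card_topFinset_le _ _⟩, hf⟩).trans_eq ?_
  rw [measure_notMem_list hX hY hf, measure_mem_list hX hY hf, sum_meanRearr]
  simp only [sum_topFinset]

end Lists

/-! ### The Fano-type inequality and its equality case -/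

section Inequality

variable {Q : PMF ℕ} {L : ℕ} {ε : ℝ} {P₁ : PMF ℕ} {X : Ω → ℕ} {Y : Ω → 𝒴}
  {μ : Measure Ω} [IsProbabilityMeasure μ] {φ : PMF ℕ → ℝ≥0∞}

theorem IsExtremal.isMajorizedBy_meanRearr (hP₁ : IsExtremal Q L ε P₁) (hε : 0 ≤ ε)
    (hXY : Feasible Q L ε X Y μ) : IsMajorizedBy P₁ (meanRearr X Y μ hXY.2.1) :=
  hP₁.isMajorizedBy _ (meanRearr_antitone hXY.2.1)
    (Fano.isMajorizedBy_meanRearr hXY.1 hXY.2.1 hXY.2.2.1)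
    (one_sub_le_sum_meanRearr hXY.1 hXY.2.1 hε hXY.2.2.2)

theorem IsSymmetric.condInfo_eq (hs : IsSymmetric φ) :
    condInfo φ X Y μ = ∫⁻ ω, φ (rearr (condPMF X Y μ (Y ω))) ∂μ :=
  lintegral_congr fun _ => hs _

theorem condInfo_le_meanRearr (hs : IsSymmetric φ) (hc : IsConcave φ) (hl : IsLSC φ)
    (hY : Measurable Y) : condInfo φ X Y μ ≤ φ (meanRearr X Y μ hY) :=
  hs.condInfo_eq.trans_le (hc.lintegral_le hl μ _ _)

theorem IsExtremal.condInfo_le (hP₁ : IsExtremal Q L ε P₁) (hε : 0 ≤ ε) (hs : IsSymmetric φ)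
    (hc : IsConcave φ) (hl : IsLSC φ) (hXY : Feasible Q L ε X Y μ) : condInfo φ X Y μ ≤ φ P₁ :=
  (condInfo_le_meanRearr hs hc hl hXY.2.1).trans
    ((hP₁.isMajorizedBy_meanRearr hε hXY).le hs hc hl hP₁.antitone)

theorem IsExtremal.isSharp (hP₁ : IsExtremal Q L ε P₁) (hε : 0 ≤ ε) (hs : IsSymmetric φ)
    (hc : IsConcave φ) (hl : IsLSC φ) (hst : IsStrict φ) (hfin : φ P₁ ≠ ∞)
    (hXY : Feasible Q L ε X Y μ) (heq : condInfo φ X Y μ = φ P₁) : IsSharp P₁ X Y μ := by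
  have hmean : meanRearr X Y μ hXY.2.1 = P₁ :=
    (hP₁.isMajorizedBy_meanRearr hε hXY).eq hs hc hl hst hP₁.antitone hfin
      (heq ▸ condInfo_le_meanRearr hs hc hl hXY.2.1)
  have hint : φ (meanRearr X Y μ hXY.2.1) ≤ ∫⁻ ω, φ (rearr (condPMF X Y μ (Y ω))) ∂μ := by
    rw [hmean, ← hs.condInfo_eq, heq]
  intro x
  rw [← hmean]
  exact hc.ae_eq_barycenter hl hst μ _ _
    (show φ (meanRearr X Y μ hXY.2.1) ≠ ∞ by rwa [hmean]) hint x

theorem IsSharp.ae_eq (h : IsSharp P₁ X Y μ) : ∀ᵐ ω ∂μ, rearr (condPMF X Y μ (Y ω)) = P₁ :=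
  (ae_all_iff.2 h).mono fun _ hω => PMF.ext hω

theorem IsSharp.condInfo_eq (h : IsSharp P₁ X Y μ) (hs : IsSymmetric φ) :
    condInfo φ X Y μ = φ P₁ := by
  have hφ : ∀ᵐ ω ∂μ, φ (rearr (condPMF X Y μ (Y ω))) = φ P₁ := h.ae_eq.mono fun ω hω => by rw [hω]
  rw [hs.condInfo_eq, lintegral_congr_ae hφ, lintegral_const, measure_univ, mul_one]

theorem IsSharp.meanRearr_eq (h : IsSharp P₁ X Y μ) (hY : Measurable Y) :
    meanRearr X Y μ hY = P₁ := by
  ext n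
  rw [meanRearr, barycenter_apply, lintegral_congr_ae (h n), lintegral_const, measure_univ, mul_one]

theorem IsExtremal.feasible_of_isSharp (hP₁ : IsExtremal Q L ε P₁) (hL : 1 ≤ L) (hε : ε ≤ 1)
    (hX : Measurable X) (hY : Measurable Y) (hQ : μ.map X = Q.toMeasure)
    (h : IsSharp P₁ X Y μ) : Feasible Q L ε X Y μ := by
  refine ⟨hX, hY, hQ, (listError_le hX hY hL).trans_eq ?_⟩
  rw [h.meanRearr_eq, hP₁.sum_eq, ← ENNReal.ofReal_one, ← ENNReal.ofReal_sub _ (sub_nonneg.2 hε),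
    sub_sub_cancel]

theorem IsExtremal.supInfo_le (hP₁ : IsExtremal Q L ε P₁) (hε : 0 ≤ ε) (hs : IsSymmetric φ)
    (hc : IsConcave φ) (hl : IsLSC φ) : supInfo φ Q L ε 𝒴 ≤ φ P₁ := by
  refine sSup_le ?_
  rintro _ ⟨Ω, _, μ, _, X, Y, hXY, rfl⟩
  exact hP₁.condInfo_le hε hs hc hl hXY

end Inequality

end RandomVariables

section Kernel

variable {𝒴 : Type u} [MeasurableSpace 𝒴] {κ : 𝒴 → PMF ℕ}

/-- The Markov kernel from `𝒴` to the alphabet given by a measurable family of distributions; it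
serves as `P_{X|Y}`. -/
def kernelOfPMF (κ : 𝒴 → PMF ℕ) (hκ : ∀ x, Measurable fun y => κ y x) : Kernel 𝒴 ℕ where
  toFun y := (κ y).toMeasure
  measurable' := by
    refine Measure.measurable_of_measurable_coe _ fun s hs => ?_
    simp only [PMF.toMeasure_apply _ hs]
    exact Measurable.tsum fun x =>
      Measurable.ite (MeasurableSet.const (x ∈ s)) (hκ x) measurable_const

theorem kernelOfPMF_apply_singleton (hκ : ∀ x, Measurable fun y => κ y x) (y : 𝒴) (x : ℕ) :
    kernelOfPMF κ hκ y {x} = κ y x :=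
  PMF.toMeasure_apply_singleton _ _ (measurableSet_singleton x)

instance (hκ : ∀ x, Measurable fun y => κ y x) : IsMarkovKernel (kernelOfPMF κ hκ) :=
  ⟨fun y => inferInstanceAs (IsProbabilityMeasure (κ y).toMeasure)⟩

theorem ae_condPMF_compProd_eq (ν : Measure 𝒴) [IsProbabilityMeasure ν]
    (hκ : ∀ x, Measurable fun y => κ y x) :
    ∀ᵐ y ∂ν, condPMF Prod.snd Prod.fst (ν ⊗ₘ kernelOfPMF κ hκ) y = κ y := by
  have hfst : (ν ⊗ₘ kernelOfPMF κ hκ).map Prod.fst = ν := Measure.fst_compProd ν _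
  have hae := condDistrib_ae_eq_of_measure_eq_compProd (μ := ν ⊗ₘ kernelOfPMF κ hκ)
    (Prod.fst : 𝒴 × ℕ → 𝒴) (Y := Prod.snd) (κ := kernelOfPMF κ hκ) measurable_snd.aemeasurable
    (by rw [hfst]; exact Measure.map_id)
  rw [hfst] at hae
  filter_upwards [hae] with y hy
  ext x
  rw [condPMF_apply, hy, kernelOfPMF_apply_singleton]

theorem map_snd_compProd (ν : Measure 𝒴) [SFinite ν] (hκ : ∀ x, Measurable fun y => κ y x)
    {Q : PMF ℕ} (hQ : ∀ x, ∫⁻ y, κ y x ∂ν = Q x) :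
    (ν ⊗ₘ kernelOfPMF κ hκ).map Prod.snd = Q.toMeasure := by
  refine Measure.ext_of_singleton fun x => ?_
  rw [PMF.toMeasure_apply_singleton _ _ (measurableSet_singleton x), ← hQ x,
    Measure.map_apply measurable_snd (measurableSet_singleton x),
    Measure.compProd_apply (measurable_snd (measurableSet_singleton x))]
  exact lintegral_congr fun y => kernelOfPMF_apply_singleton hκ y x

theorem IsExtremal.le_supInfo {Q : PMF ℕ} {L : ℕ} {ε : ℝ} {P₁ : PMF ℕ}
    (hP₁ : IsExtremal Q L ε P₁) (hL : 1 ≤ L) (hε : ε ≤ 1) {φ : PMF ℕ → ℝ≥0∞} (hs : IsSymmetric φ)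
    (ν : Measure 𝒴) [IsProbabilityMeasure ν] (hκ : ∀ x, Measurable fun y => κ y x)
    (hQ : ∀ x, ∫⁻ y, κ y x ∂ν = Q x) (hsharp : ∀ᵐ y ∂ν, rearr (κ y) = P₁) :
    φ P₁ ≤ supInfo φ Q L ε 𝒴 := by
  have hposterior : IsSharp P₁ Prod.snd Prod.fst (ν ⊗ₘ kernelOfPMF κ hκ) := by
    intro x
    refine ae_of_ae_map (p := fun y => rearr (condPMF Prod.snd Prod.fst (ν ⊗ₘ kernelOfPMF κ hκ) y) x
      = P₁ x) measurable_fst.aemeasurable ?_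
    rw [show (ν ⊗ₘ kernelOfPMF κ hκ).map Prod.fst = ν from Measure.fst_compProd ν _]
    filter_upwards [ae_condPMF_compProd_eq ν hκ, hsharp] with y hy hy'
    rw [hy, hy']
  rw [← hposterior.condInfo_eq hs]
  exact le_sSup ⟨𝒴 × ℕ, inferInstance, ν ⊗ₘ kernelOfPMF κ hκ, inferInstance, Prod.snd, Prod.fst,
    hP₁.feasible_of_isSharp hL hε measurable_snd measurable_fst (map_snd_compProd ν hκ hQ)
      hposterior, rfl⟩

-- The sample space of the pair may lie in another universe than those over which `supInfo` ranges,
-- so the pair is replaced by one on `𝒴 × ℕ` with the same joint law.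
theorem IsExtremal.le_supInfo_of_isSharp {Q : PMF ℕ} {L : ℕ} {ε : ℝ} {P₁ : PMF ℕ}
    (hP₁ : IsExtremal Q L ε P₁) (hL : 1 ≤ L) (hε : ε ≤ 1) {φ : PMF ℕ → ℝ≥0∞} (hs : IsSymmetric φ)
    {Ω : Type v} [MeasurableSpace Ω] {μ : Measure Ω} [IsProbabilityMeasure μ] {X : Ω → ℕ}
    {Y : Ω → 𝒴} (hX : Measurable X) (hY : Measurable Y) (hQ : μ.map X = Q.toMeasure)
    (h : IsSharp P₁ X Y μ) : φ P₁ ≤ supInfo φ Q L ε 𝒴 := by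
  have := Measure.isProbabilityMeasure_map (μ := μ) hY.aemeasurable
  refine hP₁.le_supInfo hL hε hs (μ.map Y) (measurable_condPMF X Y μ) (fun x => ?_) ?_
  · have hlist := measure_mem_list (μ := μ) hX hY (f := fun _ => {x}) fun _ => MeasurableSet.const _
    simp only [Finset.sum_singleton, Finset.mem_singleton] at hlist
    rw [lintegral_map (measurable_condPMF X Y μ x) hY, ← hlist,
      ← PMF.toMeasure_apply_singleton Q x (measurableSet_singleton x), ← hQ,
      Measure.map_apply hX (measurableSet_singleton x)]
    rfl
  · have hall : ∀ x, ∀ᵐ y ∂(μ.map Y), rearr (condPMF X Y μ y) x = P₁ x := fun x =>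
      (ae_map_iff hY.aemeasurable (measurableSet_eq_fun
        (measurable_rearr (measurable_condPMF X Y μ) x) measurable_const)).2 (h x)
    exact (ae_all_iff.2 hall).mono fun _ hy => PMF.ext hy

end Kernel

/-! ### Systematic sampling -/

/-- The systematic sample with offset `t` and inclusion probabilities `p`: lay out half-open
intervals of lengths `p 0, p 1, …` one after another from the origin and select those that meet
`t + ℤ`. -/
def systematicSample (p : ℕ → ℝ) (t : ℝ) : Set ℕ :=
  {x | ⌈∑ i ∈ Finset.range x, p i - t⌉ < ⌈∑ i ∈ Finset.range (x + 1), p i - t⌉}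

theorem ceil_sub_eq {b t : ℝ} (ht : t ∈ Set.Ico (0 : ℝ) 1) :
    ⌈b - t⌉ = ⌊b⌋ + (Set.Iio (Int.fract b)).indicator 1 t := by
  have hb := Int.floor_add_fract b
  have hb0 := Int.fract_nonneg b
  have hb1 := Int.fract_lt_one b
  obtain ⟨ht0, ht1⟩ := ht
  rw [Int.ceil_eq_iff, Set.indicator_apply]
  split_ifs with h <;> rw [Set.mem_Iio] at h <;> push_cast [Pi.one_apply] <;> constructor <;>
    linarith

theorem integrableOn_ceil_sub (b : ℝ) :
    IntegrableOn (fun t => (⌈b - t⌉ : ℝ)) (Set.Ico (0 : ℝ) 1) := by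
  refine (AntitoneOn.integrableOn_isCompact isCompact_Icc fun s _ t _ hst => ?_).mono_set
    Set.Ico_subset_Icc_self
  exact_mod_cast Int.ceil_le_ceil (sub_le_sub_left hst b)

theorem integral_ceil_sub (b : ℝ) : ∫ t in Set.Ico (0 : ℝ) 1, (⌈b - t⌉ : ℝ) = b := by
  have hceil : ∀ t ∈ Set.Ico (0 : ℝ) 1,
      (⌈b - t⌉ : ℝ) = ⌊b⌋ + (Set.Iio (Int.fract b)).indicator 1 t := fun t ht => by
    rw [ceil_sub_eq ht, Set.indicator_apply, Set.indicator_apply]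
    split_ifs <;> simp
  have hinter : Set.Iio (Int.fract b) ∩ Set.Ico 0 1 = Set.Ico 0 (Int.fract b) := by
    rw [Set.inter_comm, Set.Ico_inter_Iio, min_eq_right (Int.fract_lt_one b).le]
  have hint : Integrable ((Set.Iio (Int.fract b)).indicator (1 : ℝ → ℝ))
      (volume.restrict (Set.Ico 0 1)) := (integrable_const (1 : ℝ)).indicator measurableSet_Iio
  rw [setIntegral_congr_fun measurableSet_Ico hceil, integral_add (integrable_const _) hint,
    integral_indicator_one measurableSet_Iio, measureReal_restrict_apply measurableSet_Iio, hinter]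
  simp [Int.fract_nonneg, Int.floor_add_fract]

section Sampling

variable {p : ℕ → ℝ}

theorem ceil_sum_range_succ_sub (h0 : ∀ x, 0 ≤ p x) (h1 : ∀ x, p x ≤ 1) (t : ℝ) (x : ℕ) :
    ⌈∑ i ∈ Finset.range (x + 1), p i - t⌉ - ⌈∑ i ∈ Finset.range x, p i - t⌉ =
      (systematicSample p t).indicator 1 x := by
  classical
  have hle : ⌈∑ i ∈ Finset.range x, p i - t⌉ ≤ ⌈∑ i ∈ Finset.range (x + 1), p i - t⌉ := by
    refine Int.ceil_le_ceil ?_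
    rw [Finset.sum_range_succ]
    linarith [h0 x]
  have hle' : ⌈∑ i ∈ Finset.range (x + 1), p i - t⌉ ≤ ⌈∑ i ∈ Finset.range x, p i - t⌉ + 1 := by
    rw [← Int.ceil_add_one]
    refine Int.ceil_le_ceil ?_
    rw [Finset.sum_range_succ]
    linarith [h1 x]
  rw [Set.indicator_apply]
  split_ifs with hx <;> rw [systematicSample, Set.mem_ofPred_eq] at hx
  · rw [Pi.one_apply]
    omega
  · omega

theorem sum_indicator_systematicSample (h0 : ∀ x, 0 ≤ p x) (h1 : ∀ x, p x ≤ 1) (t : ℝ) (n : ℕ) :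
    ∑ x ∈ Finset.range n, (systematicSample p t).indicator (1 : ℕ → ℤ) x =
      ⌈∑ i ∈ Finset.range n, p i - t⌉ - ⌈-t⌉ := by
  have htele := Finset.sum_range_sub (fun n => ⌈∑ i ∈ Finset.range n, p i - t⌉) n
  rw [Finset.sum_range_zero, zero_sub] at htele
  rw [← htele]
  exact Finset.sum_congr rfl fun x _ => (ceil_sum_range_succ_sub h0 h1 t x).symm

theorem eventually_ceil_sum_range_sub_eq (h0 : ∀ x, 0 ≤ p x) {m : ℕ} (hs : HasSum p m) (t : ℝ) :
    ∀ᶠ n in atTop, ⌈∑ i ∈ Finset.range n, p i - t⌉ = m + ⌈-t⌉ := by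
  have hlt : (m : ℝ) + t + ⌈-t⌉ - 1 < m := by linarith [Int.ceil_lt_add_one (-t)]
  filter_upwards [hs.tendsto_sum_nat.eventually_const_lt hlt] with n hn
  have hle : ∑ i ∈ Finset.range n, p i ≤ m := sum_le_hasSum _ (fun i _ => h0 i) hs
  have hceil := Int.le_ceil (-t)
  rw [Int.ceil_eq_iff]
  push_cast
  constructor <;> linarith

theorem exists_finset_eq_systematicSample (h0 : ∀ x, 0 ≤ p x) (h1 : ∀ x, p x ≤ 1) {m : ℕ}
    (hs : HasSum p m) (t : ℝ) :
    ∃ s : Finset ℕ, (s : Set ℕ) = systematicSample p t ∧ s.card = m := by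
  classical
  obtain ⟨N, hN⟩ := (eventually_ceil_sum_range_sub_eq h0 hs t).exists_forall_of_atTop
  refine ⟨(Finset.range N).filter (· ∈ systematicSample p t), ?_, ?_⟩
  · ext x
    simp only [Finset.coe_filter, Finset.mem_range, Set.mem_ofPred_eq, and_iff_right_iff_imp]
    intro hx
    by_contra hxN
    have hjump : ⌈∑ i ∈ Finset.range x, p i - t⌉ < ⌈∑ i ∈ Finset.range (x + 1), p i - t⌉ := hx
    rw [hN x (by omega), hN (x + 1) (by omega)] at hjump
    exact lt_irrefl _ hjump
  · have hcount := sum_indicator_systematicSample h0 h1 t N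
    rw [hN N le_rfl, add_sub_cancel_right] at hcount
    simp only [Set.indicator_apply, Pi.one_apply, Finset.sum_boole] at hcount
    exact_mod_cast hcount

theorem measurableSet_mem_systematicSample (p : ℕ → ℝ) (x : ℕ) :
    MeasurableSet {t | x ∈ systematicSample p t} :=
  measurableSet_lt (Int.measurable_ceil.comp (measurable_const.sub measurable_id))
    (Int.measurable_ceil.comp (measurable_const.sub measurable_id))

theorem volume_mem_systematicSample (h0 : ∀ x, 0 ≤ p x) (h1 : ∀ x, p x ≤ 1) (x : ℕ) :
    volume.restrict (Set.Ico (0 : ℝ) 1) {t | x ∈ systematicSample p t} = ENNReal.ofReal (p x) := by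
  classical
  have hind : {t | x ∈ systematicSample p t}.indicator (1 : ℝ → ℝ) = fun t =>
      (⌈∑ i ∈ Finset.range (x + 1), p i - t⌉ : ℝ) - ⌈∑ i ∈ Finset.range x, p i - t⌉ := by
    ext t
    rw [← Int.cast_sub, ceil_sum_range_succ_sub h0 h1, Set.indicator_apply, Set.indicator_apply]
    split_ifs <;> simp_all
  rw [← ofReal_measureReal, ← integral_indicator_one (measurableSet_mem_systematicSample p x),
    hind, integral_sub (integrableOn_ceil_sub _) (integrableOn_ceil_sub _), integral_ceil_sub,
    integral_ceil_sub, Finset.sum_range_succ, add_sub_cancel_left]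

-- The sample changes only when the offset passes the fractional part of an endpoint.
theorem exists_systematicSample_eq (p : ℕ → ℝ) {B : Finset ℝ}
    (hB : ∀ n, Int.fract (∑ i ∈ Finset.range n, p i) ∈ B) {t : ℝ} (ht : t ∈ Set.Ico (0 : ℝ) 1) :
    ∃ b ∈ B, systematicSample p b = systematicSample p t := by
  have h0B : (0 : ℝ) ∈ B := by simpa using hB 0
  obtain ⟨b, hb, hmax⟩ := (B.filter (· ≤ t)).exists_max_image id
    ⟨0, Finset.mem_filter.2 ⟨h0B, ht.1⟩⟩
  obtain ⟨hbB, hbt⟩ := Finset.mem_filter.1 hb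
  have hb01 : b ∈ Set.Ico (0 : ℝ) 1 :=
    ⟨hmax 0 (Finset.mem_filter.2 ⟨h0B, ht.1⟩), hbt.trans_lt ht.2⟩
  have hceil : ∀ n, ⌈∑ i ∈ Finset.range n, p i - b⌉ = ⌈∑ i ∈ Finset.range n, p i - t⌉ := by
    intro n
    have hiff : b ∈ Set.Iio (Int.fract (∑ i ∈ Finset.range n, p i)) ↔
        t ∈ Set.Iio (Int.fract (∑ i ∈ Finset.range n, p i)) :=
      ⟨fun h => not_le.1 fun hle => (hmax _ (Finset.mem_filter.2 ⟨hB n, hle⟩)).not_gt h,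
        hbt.trans_lt⟩
    simp only [ceil_sub_eq hb01, ceil_sub_eq ht, Set.indicator_apply, hiff]
    rfl
  exact ⟨b, hbB, by simp only [systematicSample, hceil]⟩

theorem fract_sum_range_mem_image {m j k : ℕ} (hjk : j < k) (hs : HasSum p m)
    (hp : ∀ x, p x ≠ 0 → j ≤ x ∧ x < k) (n : ℕ) : Int.fract (∑ i ∈ Finset.range n, p i) ∈
      (Finset.Ico j k).image fun n => Int.fract (∑ i ∈ Finset.range n, p i) := by
  have hj : ∀ n ≤ j, ∑ i ∈ Finset.range n, p i = 0 := fun n hn =>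
    Finset.sum_eq_zero fun i hi => by
      by_contra h
      have := (hp i h).1
      have := Finset.mem_range.1 hi
      omega
  have hk : ∀ n, k ≤ n → ∑ i ∈ Finset.range n, p i = m := fun n hn =>
    (hasSum_sum_of_ne_finset_zero fun i hi => by
      by_contra h
      exact hi (Finset.mem_range.2 ((hp i h).2.trans_le hn))).unique hs
  have hzero : (0 : ℝ) ∈ (Finset.Ico j k).image fun n => Int.fract (∑ i ∈ Finset.range n, p i) :=
    Finset.mem_image.2 ⟨j, Finset.mem_Ico.2 ⟨le_rfl, hjk⟩, by rw [hj j le_rfl, Int.fract_zero]⟩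
  rcases lt_or_ge n j with hn | hjn
  · rwa [hj n hn.le, Int.fract_zero]
  rcases lt_or_ge n k with hnk | hn
  · exact Finset.mem_image_of_mem _ (Finset.mem_Ico.2 ⟨hjn, hnk⟩)
  · rwa [hk n hn, Int.fract_natCast]

theorem measurable_of_coe_eq_systematicSample {τ : ℝ → Finset ℕ}
    (hτ : ∀ t, (τ t : Set ℕ) = systematicSample p t) : Measurable[_, ⊤] τ := by
  let _ : MeasurableSpace (Finset ℕ) := ⊤
  refine measurable_to_countable' fun s => ?_
  have hpre : τ ⁻¹' {s} = ⋂ x, {t | x ∈ systematicSample p t ↔ x ∈ s} := by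
    ext t
    simp [← hτ, Finset.ext_iff]
  rw [hpre]
  refine MeasurableSet.iInter fun x => ?_
  by_cases hx : x ∈ s
  · simpa only [hx, iff_true] using measurableSet_mem_systematicSample p x
  · simpa only [hx, iff_false] using! (measurableSet_mem_systematicSample p x).compl

theorem exists_random_finset {m : ℕ} (h0 : ∀ x, 0 ≤ p x) (h1 : ∀ x, p x ≤ 1) (hs : HasSum p m) :
    ∃ π : PMF (Finset ℕ), (∀ s ∈ π.support, s.card = m) ∧
      (∀ x, π.toOuterMeasure {s | x ∈ s} = ENNReal.ofReal (p x)) ∧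
      ∀ j k, j < k → (∀ x, p x ≠ 0 → j ≤ x ∧ x < k) → π.support.encard ≤ (k - j : ℕ) := by
  classical
  choose τ hτ hcard using exists_finset_eq_systematicSample h0 h1 hs
  let _ : MeasurableSpace (Finset ℕ) := ⊤
  have : MeasurableSingletonClass (Finset ℕ) := ⟨fun _ => trivial⟩
  have hτm : Measurable τ := measurable_of_coe_eq_systematicSample hτ
  have : IsProbabilityMeasure (volume.restrict (Set.Ico (0 : ℝ) 1)) := ⟨by simp⟩
  have := Measure.isProbabilityMeasure_map (μ := volume.restrict (Set.Ico (0 : ℝ) 1))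
    hτm.aemeasurable
  have hsupp : ∀ s ∈ ((volume.restrict (Set.Ico (0 : ℝ) 1)).map τ).toPMF.support,
      ∃ t ∈ Set.Ico (0 : ℝ) 1, τ t = s := by
    intro s hs
    rw [PMF.mem_support_iff, Measure.toPMF_apply, Measure.map_apply hτm trivial,
      Measure.restrict_apply (hτm trivial)] at hs
    obtain ⟨t, hts, ht⟩ := nonempty_of_measure_ne_zero hs
    exact ⟨t, ht, hts⟩
  refine ⟨((volume.restrict (Set.Ico (0 : ℝ) 1)).map τ).toPMF, fun s hs => ?_, fun x => ?_,
    fun j k hjk hp => ?_⟩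
  · obtain ⟨t, -, rfl⟩ := hsupp s hs
    exact hcard t
  · rw [← PMF.toMeasure_apply_eq_toOuterMeasure, Measure.toPMF_toMeasure,
      Measure.map_apply hτm trivial, ← volume_mem_systematicSample h0 h1]
    simp only [← hτ]
    rfl
  · let B := (Finset.Ico j k).image fun n => Int.fract (∑ i ∈ Finset.range n, p i)
    have hsub : ((volume.restrict (Set.Ico (0 : ℝ) 1)).map τ).toPMF.support ⊆
        (B.image τ : Finset (Finset ℕ)) := by
      intro s hs
      obtain ⟨t, ht, rfl⟩ := hsupp s hs
      obtain ⟨b, hb, hbt⟩ := exists_systematicSample_eq p (fract_sum_range_mem_image hjk ‹_› hp) ht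
      rw [← hτ, ← hτ] at hbt
      exact Finset.mem_coe.2 (Finset.mem_image.2 ⟨b, hb, Finset.coe_injective hbt⟩)
    refine (Set.encard_le_encard hsub).trans ?_
    rw [Set.encard_coe_eq_coe_finsetCard, Nat.cast_le, ← Nat.card_Ico]
    exact Finset.card_image_le.trans Finset.card_image_le

end Sampling

/-! ### Attaining the bound -/

section Mixture

variable {ι : Type*} {π : PMF ι} {κ : π.support → PMF ℕ} {Q : PMF ℕ}

theorem tsum_support_mul (π : PMF ι) (g : ι → ℝ≥0∞) :
    ∑' s : π.support, π s * g s = ∑' s, π s * g s :=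
  tsum_subtype_eq_of_support_subset (f := fun s => π s * g s) fun _ hs => left_ne_zero_of_mul hs

theorem exists_rearr_eq_of_rearr_eq_zero {P : PMF ℕ} (h : ∀ n, rearr Q n = 0 → P n = 0) :
    ∃ R : PMF ℕ, rearr R = rearr P ∧ ⇑R = Q.support.indicator (P ∘ rank Q) := by
  have himage : ∀ n, P n ≠ 0 → n ∈ rank Q '' Q.support := fun n hn =>
    exists_rank_eq (mt (h n) hn)
  have hsum : ∑' x, Q.support.indicator (P ∘ rank Q) x = 1 := by
    rw [← tsum_subtype, ← P.tsum_coe, ← tsum_subtype_eq_of_support_subset (f := P) himage]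
    exact (tsum_image P (rank_injOn Q)).symm
  refine ⟨mkPMF _ hsum, rearr_congr fun t => ?_, rfl⟩
  have hsub : {x | t < mkPMF _ hsum x} ⊆ Q.support := fun x hx =>
    Set.mem_of_indicator_ne_zero (s := Q.support) (f := P ∘ rank Q) (pos_of_gt hx).ne'
  rw [← ((rank_injOn Q).mono hsub).encard_image]
  congr 1
  ext n
  constructor
  · rintro ⟨x, hx, rfl⟩
    rwa [Set.mem_ofPred_eq, mkPMF_apply, Set.indicator_of_mem (hsub hx)] at hx
  · intro hn
    obtain ⟨x, hx, rfl⟩ := himage n (pos_of_gt hn).ne'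
    exact ⟨x, by rwa [Set.mem_ofPred_eq, mkPMF_apply, Set.indicator_of_mem hx], rfl⟩

theorem exists_mixture_of_rearr (hQ : ∀ n, rearr Q n = ∑' s : π.support, π s * κ s n) :
    ∃ κ' : π.support → PMF ℕ, (∀ s, rearr (κ' s) = rearr (κ s)) ∧
      ∀ x, Q x = ∑' s : π.support, π s * κ' s x := by
  have hzero : ∀ s n, rearr Q n = 0 → κ s n = 0 := fun s n hn =>
    (mul_eq_zero.1 (ENNReal.tsum_eq_zero.1 ((hQ n).symm.trans hn) s)).resolve_left s.2
  choose κ' hrearr hκ' using fun s => exists_rearr_eq_of_rearr_eq_zero (hzero s)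
  refine ⟨κ', hrearr, fun x => ?_⟩
  by_cases hx : Q x = 0
  · simp [hκ', hx]
  · have hmem : x ∈ Q.support := hx
    simp only [hκ', Set.indicator_of_mem hmem, Function.comp_apply, ← hQ, rearr_rank hx]

theorem IsExtremal.le_supInfo_of_mixture {L : ℕ} {ε : ℝ} {P₁ : PMF ℕ} (hP₁ : IsExtremal Q L ε P₁)
    (hL : 1 ≤ L) (hε : ε ≤ 1) {φ : PMF ℕ → ℝ≥0∞} (hs : IsSymmetric φ) {𝒴 : Type u}
    [MeasurableSpace 𝒴] [MeasurableSingletonClass 𝒴] (hκ : ∀ s, rearr (κ s) = P₁)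
    (hQ : ∀ x, Q x = ∑' s : π.support, π s * κ s x) (f : π.support ↪ 𝒴) :
    φ P₁ ≤ supInfo φ Q L ε 𝒴 := by
  have hext : ∀ s, Function.extend f κ (fun _ => Q) (f s) = κ s := f.injective.extend_apply κ _
  have : Countable π.support := π.support_countable.to_subtype
  let ν : Measure 𝒴 := Measure.sum fun s : π.support => π s • Measure.dirac (f s)
  have hν : IsProbabilityMeasure ν := ⟨by
    simpa [ν, Measure.sum_apply, π.tsum_coe] using tsum_support_mul π 1⟩
  refine hP₁.le_supInfo (κ := Function.extend f κ fun _ => Q) hL hε hs ν (fun x => ?_)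
    (fun x => ?_) ?_
  · refine (measurable_const (a := Q x)).measurable_of_countable_ne
      ((Set.countable_range f).mono fun y hy => ?_)
    by_contra hy'
    exact hy (by rw [Function.extend_apply' _ _ _ hy'])
  · simp only [ν, lintegral_sum_measure, lintegral_smul_measure, lintegral_dirac, hext, hQ x,
      smul_eq_mul]
  · refine Measure.ae_sum_iff.2 fun s => Measure.ae_smul_measure ?_ _
    rw [ae_dirac_eq, eventually_pure, hext, hκ]

end Mixture

theorem exists_perm_mem_iff_mem {α : Type*} [DecidableEq α] {s t : Finset α}
    (h : s.card = t.card) :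
    ∃ σ : Equiv.Perm α, (∀ x, σ x ∈ t ↔ x ∈ s) ∧ ∀ x ∉ s ∪ t, σ x = x := by
  let e : {x : ↥(s ∪ t) // (x : α) ∈ s} ≃ {x : ↥(s ∪ t) // (x : α) ∈ t} :=
    (Equiv.subtypeSubtypeEquivSubtype fun hx => Finset.mem_union_left t hx).trans <|
      (Finset.equivOfCardEq h).trans
        (Equiv.subtypeSubtypeEquivSubtype fun hx => Finset.mem_union_right s hx).symm
  have hfix : ∀ x ∉ s ∪ t, Equiv.Perm.ofSubtype e.extendSubtype x = x := fun x hx =>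
    Equiv.Perm.ofSubtype_apply_of_not_mem _ hx
  refine ⟨Equiv.Perm.ofSubtype e.extendSubtype, fun x => ?_, hfix⟩
  by_cases hx : x ∈ s ∪ t
  · rw [Equiv.Perm.ofSubtype_apply_of_mem _ hx]
    exact ⟨not_imp_not.1 (e.extendSubtype_not_mem ⟨x, hx⟩), e.extendSubtype_mem ⟨x, hx⟩⟩
  · rw [hfix x hx]
    rw [Finset.mem_union, not_or] at hx
    exact iff_of_false hx.2 hx.1

namespace IsFanoParams

/-- The part of the mass function `Q↓` that is common to `Q↓` and to all the distributions of which
`Q↓` is going to be a mixture: on `[j, k)` each of these raises some masses from `w` to `v`. -/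
def baseMass (Q : PMF ℕ) (j : ℕ) (k : ℕ∞) (w : ℝ) (x : ℕ) : ℝ :=
  if j ≤ x ∧ x < k then w else (rearr Q x).toReal

/-- The probability with which the mass at `x` has to be raised from `w` to `v` in order to have
mean `Q↓(x)`. -/
def raiseProb (Q : PMF ℕ) (j : ℕ) (k : ℕ∞) (v w : ℝ) (x : ℕ) : ℝ :=
  if j ≤ x ∧ x < k then ((rearr Q x).toReal - w) / (v - w) else 0

variable {Q : PMF ℕ} {L j : ℕ} {c v w : ℝ} {k : ℕ∞}

theorem j_lt_k (h : IsFanoParams Q L c j k v w) : (j : ℕ∞) < k :=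
  (Nat.cast_lt.2 h.j_lt).trans h.lt_k

theorem v_sub_w_pos (h : IsFanoParams Q L c j k v w) : 0 < v - w :=
  sub_pos.2 ((h.w_lt j h.j_lt_k).trans h.lt_v)

theorem baseMass_nonneg (h : IsFanoParams Q L c j k v w) (x : ℕ) : 0 ≤ baseMass Q j k w x :=
  ite_nonneg h.w_nonneg ENNReal.toReal_nonneg

theorem baseMass_add_raiseProb_mul (h : IsFanoParams Q L c j k v w) (x : ℕ) :
    baseMass Q j k w x + raiseProb Q j k v w x * (v - w) = (rearr Q x).toReal := by
  rw [baseMass, raiseProb]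
  split_ifs
  · rw [div_mul_cancel₀ _ h.v_sub_w_pos.ne', add_sub_cancel]
  · rw [zero_mul, add_zero]

theorem levelledMass_eq_baseMass_add (h : IsFanoParams Q L c j k v w) (x : ℕ) :
    levelledMass Q L v w x =
      baseMass Q j k w x + (if x ∈ Finset.Ico j L then 1 else 0) * (v - w) := by
  simp only [baseMass, Finset.mem_Ico]
  rcases lt_or_ge x j with hj | hj
  · rw [h.levelledMass_of_lt_j hj, if_neg (by omega), if_neg (by omega), zero_mul, add_zero]
  rcases lt_or_ge x L with hL | hL
  · rw [h.levelledMass_of_lt_L hj hL, if_pos ⟨hj, (Nat.cast_lt.2 hL).trans h.lt_k⟩,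
      if_pos ⟨hj, hL⟩, one_mul, add_sub_cancel]
  rw [if_neg (c := j ≤ x ∧ x < L) (by omega), zero_mul, add_zero]
  split_ifs with hk
  · exact h.levelledMass_of_lt_k hL hk.2
  · exact h.levelledMass_of_k_le (not_lt.1 fun hxk => hk ⟨hj, hxk⟩)

theorem mem_Ico_of_raiseProb_ne_zero {x : ℕ} (hx : raiseProb Q j k v w x ≠ 0) :
    j ≤ x ∧ x < k := by
  by_contra hn
  exact hx (if_neg hn)

theorem raiseProb_nonneg (h : IsFanoParams Q L c j k v w) (x : ℕ) : 0 ≤ raiseProb Q j k v w x := by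
  rw [raiseProb]
  split_ifs with hx
  · exact div_nonneg (sub_nonneg.2 (h.w_lt x hx.2).le) h.v_sub_w_pos.le
  · exact le_rfl

theorem raiseProb_le_one (h : IsFanoParams Q L c j k v w) (x : ℕ) : raiseProb Q j k v w x ≤ 1 := by
  rw [raiseProb]
  split_ifs with hx
  · exact div_le_one_of_le₀ (sub_le_sub_right
      ((toReal_rearr_antitone Q hx.1).trans h.lt_v.le) w) h.v_sub_w_pos.le
  · exact zero_le_one

theorem hasSum_raiseProb (h : IsFanoParams Q L c j k v w) :
    HasSum (raiseProb Q j k v w) (L - j : ℕ) := by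
  have hind : HasSum (fun x => if x ∈ Finset.Ico j L then (1 : ℝ) else 0) (L - j : ℕ) := by
    simpa only [Finset.sum_ite_mem, Finset.inter_self, Finset.sum_const, Nat.card_Ico, nsmul_one]
      using hasSum_sum_of_ne_finset_zero (L := .unconditional ℕ)
      (s := Finset.Ico j L) (f := fun x => if x ∈ Finset.Ico j L then (1 : ℝ) else 0)
      fun x hx => if_neg hx
  have hdiff := (((hasSum_toReal (rearr Q)).sub h.hasSum_levelledMass).div_const (v - w)).add hind
  rw [sub_self, zero_div, zero_add] at hdiff
  refine hdiff.congr_fun fun x => ?_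
  rw [← h.baseMass_add_raiseProb_mul, h.levelledMass_eq_baseMass_add, add_sub_add_left_eq_sub,
    ← sub_mul, mul_div_cancel_right₀ _ h.v_sub_w_pos.ne', sub_add_cancel]

theorem exists_perm_toPMF (h : IsFanoParams Q L c j k v w) {s : Finset ℕ} (hcard : s.card = L - j)
    (hs : ∀ x ∈ s, j ≤ x ∧ (x : ℕ∞) < k) : ∃ σ : Equiv.Perm ℕ, ∀ x, permute σ h.toPMF x =
      ENNReal.ofReal (baseMass Q j k w x) + if x ∈ s then ENNReal.ofReal (v - w) else 0 := by
  obtain ⟨σ, hσ, hfix⟩ := exists_perm_mem_iff_mem (hcard.trans (Nat.card_Ico j L).symm)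
  have hunion : ∀ x ∈ s ∪ Finset.Ico j L, j ≤ x ∧ (x : ℕ∞) < k := fun x hx =>
    (Finset.mem_union.1 hx).elim (hs x) fun hx => ⟨(Finset.mem_Ico.1 hx).1,
      (Nat.cast_lt.2 (Finset.mem_Ico.1 hx).2).trans h.lt_k⟩
  have hbase : ∀ x, baseMass Q j k w (σ x) = baseMass Q j k w x := fun x => by
    by_cases hx : x ∈ s ∪ Finset.Ico j L
    · have hσx : σ x ∈ s ∪ Finset.Ico j L := by
        by_contra hn
        exact hn ((σ.injective (hfix _ hn)).symm ▸ hx)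
      rw [baseMass, baseMass, if_pos (hunion _ hσx), if_pos (hunion _ hx)]
    · rw [hfix x hx]
  refine ⟨σ, fun x => ?_⟩
  rw [permute_apply, toPMF, mkPMF_apply, h.levelledMass_eq_baseMass_add, hbase,
    ENNReal.ofReal_add (h.baseMass_nonneg x) (mul_nonneg (ite_nonneg zero_le_one le_rfl)
      h.v_sub_w_pos.le)]
  simp only [hσ]
  split_ifs <;> simp

theorem rearr_eq_tsum (h : IsFanoParams Q L c j k v w) {π : PMF (Finset ℕ)}
    (hπ : ∀ x, π.toOuterMeasure {s | x ∈ s} = ENNReal.ofReal (raiseProb Q j k v w x)) (x : ℕ) :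
    rearr Q x = ∑' s : π.support, π s *
      (ENNReal.ofReal (baseMass Q j k w x) + if x ∈ s.1 then ENNReal.ofReal (v - w) else 0) := by
  have hmem : ∑' s, π s * (if x ∈ s then ENNReal.ofReal (v - w) else 0) =
      ENNReal.ofReal (raiseProb Q j k v w x * (v - w)) := by
    rw [ENNReal.ofReal_mul (h.raiseProb_nonneg x), ← hπ, PMF.toOuterMeasure_apply,
      ← ENNReal.tsum_mul_right]
    refine tsum_congr fun s => ?_
    simp only [Set.indicator_apply, Set.mem_ofPred_eq]
    split_ifs <;> simp
  rw [tsum_support_mul π fun s =>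
    ENNReal.ofReal (baseMass Q j k w x) + if x ∈ s then ENNReal.ofReal (v - w) else 0]
  simp only [mul_add]
  rw [ENNReal.tsum_add, ENNReal.tsum_mul_right, π.tsum_coe, one_mul, hmem,
    ← ENNReal.ofReal_add (h.baseMass_nonneg x)
      (mul_nonneg (h.raiseProb_nonneg x) h.v_sub_w_pos.le), h.baseMass_add_raiseProb_mul,
    ENNReal.ofReal_toReal (PMF.apply_ne_top _ _)]

theorem exists_mixture (h : IsFanoParams Q L c j k v w) :
    ∃ (π : PMF (Finset ℕ)) (κ : π.support → PMF ℕ), (∀ s, rearr (κ s) = h.toPMF) ∧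
      (∀ x, Q x = ∑' s : π.support, π s * κ s x) ∧
      ∀ m : ℕ, k = m → π.support.encard ≤ (m - j : ℕ) := by
  obtain ⟨π, hcard, hincl, hsupp⟩ :=
    exists_random_finset h.raiseProb_nonneg h.raiseProb_le_one h.hasSum_raiseProb
  have hmem : ∀ s ∈ π.support, ∀ x ∈ s, j ≤ x ∧ (x : ℕ∞) < k := by
    intro s hs x hx
    refine mem_Ico_of_raiseProb_ne_zero (Q := Q) (v := v) (w := w) fun hzero => ?_
    have hdisj := hincl x
    rw [hzero, ENNReal.ofReal_zero, PMF.toOuterMeasure_apply_eq_zero_iff] at hdisj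
    exact Set.disjoint_left.1 hdisj hs hx
  choose σ hσ using fun s : π.support => h.exists_perm_toPMF (hcard s s.2) (hmem s s.2)
  obtain ⟨κ, hκ, hQ⟩ := exists_mixture_of_rearr (κ := fun s => permute (σ s) h.toPMF) fun x => by
    simpa only [hσ] using h.rearr_eq_tsum hincl x
  refine ⟨π, κ, fun s => ?_, hQ, fun m hm => ?_⟩
  · rw [hκ, rearr_permute, rearr_eq_self h.toPMF_antitone]
  · subst hm
    exact hsupp j m (Nat.cast_lt.1 h.j_lt_k) fun x hx =>
      (mem_Ico_of_raiseProb_ne_zero hx).imp_right Nat.cast_lt.1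

theorem le_supInfo {ε : ℝ} (h : IsFanoParams Q L (1 - ε) j k v w) (hε : ε ≤ 1)
    {φ : PMF ℕ → ℝ≥0∞} (hs : IsSymmetric φ) {𝒴 : Type u} [MeasurableSpace 𝒴]
    [MeasurableSingletonClass 𝒴]
    (h𝒴 : Infinite 𝒴 ∨ ∃ m : ℕ, k = m ∧ ((m - j : ℕ) : Cardinal.{u}) ≤ Cardinal.mk 𝒴) :
    φ h.toPMF ≤ supInfo φ Q L ε 𝒴 := by
  obtain ⟨π, κ, hκ, hQ, hsupp⟩ := h.exists_mixture
  have hcard : Cardinal.lift.{u} (Cardinal.mk π.support) ≤ Cardinal.lift.{0} (Cardinal.mk 𝒴) := by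
    rw [Cardinal.lift_uzero]
    rcases h𝒴 with hinf | ⟨m, hm, hle⟩
    · exact (Cardinal.lift_le_aleph0.2 Cardinal.mk_le_aleph0).trans (Cardinal.aleph0_le_mk 𝒴)
    · exact (Cardinal.lift_le_nat_iff.2 (Cardinal.toENat_le_natCast.1 (hsupp m hm))).trans hle
  obtain ⟨f⟩ := Cardinal.lift_mk_le'.1 hcard
  exact h.isExtremal.le_supInfo_of_mixture (Nat.one_le_of_lt h.j_lt) hε hs hκ hQ f

end IsFanoParams

theorem le_choose {n m : ℕ} (h1 : 1 ≤ m) (h2 : m < n) : n ≤ n.choose m := by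
  induction n, h2 using Nat.le_induction with
  | base => rw [Nat.choose_succ_self_right]
  | succ n hn ih =>
    obtain ⟨m, rfl⟩ := Nat.exists_eq_succ_of_ne_zero (Nat.one_le_iff_ne_zero.1 h1)
    rw [Nat.choose_succ_succ]
    have hpos : 0 < n.choose m := Nat.choose_pos (by omega)
    omega

theorem le_supInfo_of_eq_rearr {Q : PMF ℕ} {L : ℕ} {ε : ℝ} (hP₁ : IsExtremal Q L ε (rearr Q))
    (hL : 1 ≤ L) (hε : ε ≤ 1) {φ : PMF ℕ → ℝ≥0∞} (hs : IsSymmetric φ) (𝒴 : Type u)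
    [MeasurableSpace 𝒴] [Nonempty 𝒴] : φ (rearr Q) ≤ supInfo φ Q L ε 𝒴 := by
  obtain ⟨y⟩ := ‹Nonempty 𝒴›
  exact hP₁.le_supInfo (κ := fun _ => Q) hL hε hs (Measure.dirac y) (fun _ => measurable_const)
    (fun x => by simp) (Eventually.of_forall fun _ => rfl)

theorem IsFanoParams.exists_natCast_le_of_spade {Q : PMF ℕ} {L : ℕ} {c ε v w : ℝ} {𝒴 : Type u}
    (h : IsFanoParams Q L c (J Q L ε - 1) (K Q L ε) v w) (hJ : 1 ≤ J Q L ε) (hY : Spade Q L ε 𝒴) :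
    ∃ k : ℕ, K Q L ε = k ∧ ((k - (J Q L ε - 1) : ℕ) : Cardinal.{u}) ≤ Cardinal.mk 𝒴 := by
  obtain ⟨k, hk, hle⟩ := hY
  have hjL := h.j_lt
  have hLk := h.lt_k
  rw [hk, Nat.cast_lt] at hLk
  refine ⟨k, hk, le_trans (Nat.cast_le.2 (le_min ?_ ?_)) hle⟩
  · have hchoose := le_choose (n := k + 1 - J Q L ε) (m := L + 1 - J Q L ε) (by omega) (by omega)
    omega
  · have hpow := Nat.le_self_pow two_ne_zero (k - J Q L ε)
    omega

theorem marginalError_le_one (Q : PMF ℕ) (L : ℕ) : marginalError Q L ≤ 1 := by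
  rw [marginalError_eq]
  exact sub_le_self _ (Finset.sum_nonneg fun _ _ => ENNReal.toReal_nonneg)

end Fano

end

theorem theorem1_general (Q : PMF ℕ) (L : ℕ) (hL : 1 ≤ L) (ε : ℝ) (h0 : 0 ≤ ε)
    (hε : ε ≤ Fano.marginalError Q L) (𝒴 : Type u) [Nonempty 𝒴] :
    ∃ P₁ : PMF ℕ, Fano.IsFanoType1 Q L ε P₁ ∧
      ∀ (_ : MeasurableSpace 𝒴) (φ : PMF ℕ → ℝ≥0∞),
        Fano.IsSymmetric φ → Fano.IsConcave φ → Fano.IsLSC φ →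
        Fano.supInfo φ Q L ε 𝒴 ≤ φ P₁ ∧
        ((ε = Fano.marginalError Q L ∨
            MeasurableSingletonClass 𝒴 ∧ (Fano.Spade Q L ε 𝒴 ∨ Infinite 𝒴)) →
          Fano.supInfo φ Q L ε 𝒴 = φ P₁) ∧
        (∀ (Ω : Type v) (_ : MeasurableSpace Ω) (μ : Measure Ω) (_ : IsProbabilityMeasure μ)
          (X : Ω → ℕ) (Y : Ω → 𝒴), Measurable X → Measurable Y → μ.map X = Q.toMeasure →
          Fano.IsSharp P₁ X Y μ →
          Fano.Feasible Q L ε X Y μ ∧ Fano.condInfo φ X Y μ = Fano.supInfo φ Q L ε 𝒴 ∧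
            Fano.supInfo φ Q L ε 𝒴 = φ P₁) ∧
        (Fano.IsStrict φ → φ P₁ ≠ ∞ →
          ∀ (Ω : Type v) (_ : MeasurableSpace Ω) (μ : Measure Ω) (_ : IsProbabilityMeasure μ)
          (X : Ω → ℕ) (Y : Ω → 𝒴), Measurable X → Measurable Y → μ.map X = Q.toMeasure →
          ((Fano.Feasible Q L ε X Y μ ∧ Fano.condInfo φ X Y μ = Fano.supInfo φ Q L ε 𝒴 ∧
            Fano.supInfo φ Q L ε 𝒴 = φ P₁) ↔ Fano.IsSharp P₁ X Y μ)) := by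
  have h1 : ε ≤ 1 := hε.trans (Fano.marginalError_le_one Q L)
  obtain ⟨P₁, hF, hE, hcase⟩ := Fano.exists_isFanoType1 hL h0 hε
  refine ⟨P₁, hF, fun _ φ hs hc hl => ?_⟩
  have hle : Fano.supInfo φ Q L ε 𝒴 ≤ φ P₁ := hE.supInfo_le h0 hs hc hl
  have hsharp : ∀ (Ω : Type v) (_ : MeasurableSpace Ω) (μ : Measure Ω) (_ : IsProbabilityMeasure μ)
      (X : Ω → ℕ) (Y : Ω → 𝒴), Measurable X → Measurable Y → μ.map X = Q.toMeasure →
      Fano.IsSharp P₁ X Y μ → Fano.Feasible Q L ε X Y μ ∧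
        Fano.condInfo φ X Y μ = Fano.supInfo φ Q L ε 𝒴 ∧ Fano.supInfo φ Q L ε 𝒴 = φ P₁ := by
    intro Ω _ μ _ X Y hX hY hQ h
    have heq := hle.antisymm (hE.le_supInfo_of_isSharp hL h1 hs hX hY hQ h)
    exact ⟨hE.feasible_of_isSharp hL h1 hX hY hQ h, (h.condInfo_eq hs).trans heq.symm, heq⟩
  refine ⟨hle, fun hattain => hle.antisymm ?_, hsharp, fun hst hfin Ω _ μ _ X Y hX hY hQ =>
    ⟨fun h => hE.isSharp h0 hs hc hl hst hfin h.1 (h.2.1.trans h.2.2),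
      hsharp Ω _ μ inferInstance X Y hX hY hQ⟩⟩
  rcases hcase with rfl | ⟨hlt, v, w, hpar, rfl⟩
  · exact Fano.le_supInfo_of_eq_rearr hE hL h1 hs 𝒴
  rcases hattain with h | ⟨_, hspade | hinf⟩
  · exact absurd h hlt.ne
  · exact hpar.le_supInfo h1 hs
      (.inr (hpar.exists_natCast_le_of_spade (Fano.J_mem Q hL ε).1 hspade))
  · exact hpar.le_supInfo h1 hs (.inl hinf)

theorem theorem1 (Q : PMF ℕ) (L : ℕ) (hL : 1 ≤ L) (ε : ℝ) (𝒴 : Type u)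
    (hε : Fano.InRange Q L ε 𝒴) :
    ∃ P₁ : PMF ℕ, Fano.IsFanoType1 Q L ε P₁ ∧
      (∀ (_ : MeasurableSpace 𝒴) (φ : PMF ℕ → ℝ≥0∞),
        Fano.IsSymmetric φ → Fano.IsConcave φ → Fano.IsLSC φ →
        -- the Fano-type inequality
        Fano.supInfo φ Q L ε 𝒴 ≤ φ P₁ ∧
        -- four sufficient conditions for equality
        (StandardBorelSpace 𝒴 →
          (ε = Fano.marginalError Q L ∨
            (Fano.Spade Q L ε 𝒴 ∧ 0 < ε ∧ ε < Fano.marginalError Q L) ∨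
            (Fano.Spade Q L ε 𝒴 ∧ Q.support.Finite) ∨
            (Fano.J Q L ε = L ∧ Cardinal.mk 𝒴 = Cardinal.aleph0)) →
          Fano.supInfo φ Q L ε 𝒴 = φ P₁) ∧
        -- a pair with almost surely constant rearranged posterior `P₁` is optimal
        (∀ (Ω : Type v) (_ : MeasurableSpace Ω) (μ : Measure Ω) (_ : IsProbabilityMeasure μ)
          (X : Ω → ℕ) (Y : Ω → 𝒴), Measurable X → Measurable Y → μ.map X = Q.toMeasure →
          Fano.IsSharp P₁ X Y μ →
          Fano.Feasible Q L ε X Y μ ∧ Fano.condInfo φ X Y μ = Fano.supInfo φ Q L ε 𝒴 ∧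
            Fano.supInfo φ Q L ε 𝒴 = φ P₁) ∧
        -- under strict concavity this characterizes the pairs attaining equality
        (Fano.IsStrict φ → φ P₁ ≠ ∞ →
          ∀ (Ω : Type v) (_ : MeasurableSpace Ω) (μ : Measure Ω) (_ : IsProbabilityMeasure μ)
          (X : Ω → ℕ) (Y : Ω → 𝒴), Measurable X → Measurable Y → μ.map X = Q.toMeasure →
          ((Fano.Feasible Q L ε X Y μ ∧ Fano.condInfo φ X Y μ = Fano.supInfo φ Q L ε 𝒴 ∧
            Fano.supInfo φ Q L ε 𝒴 = φ P₁) ↔ Fano.IsSharp P₁ X Y μ))) ∧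
      -- for `|𝒴| ≥ 𝔠` a suitable σ-algebra gives equality
      (Cardinal.continuum ≤ Cardinal.mk 𝒴 →
        ∃ _ : MeasurableSpace 𝒴, ∀ φ : PMF ℕ → ℝ≥0∞,
          Fano.IsSymmetric φ → Fano.IsConcave φ → Fano.IsLSC φ →
          Fano.supInfo φ Q L ε 𝒴 = φ P₁) := by
  have := Fano.nonempty_of_inRange hL hε
  obtain ⟨P₁, hF, hP₁⟩ := theorem1_general Q L hL ε (Fano.nonneg_of_inRange hε) hε.2 𝒴
  refine ⟨P₁, hF, fun m φ hs hc hl => ?_, fun hcard => ⟨⊤, fun φ hs hc hl => ?_⟩⟩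
  · obtain ⟨hle, heq, hrest⟩ := hP₁ m φ hs hc hl
    refine ⟨hle, fun _ hcond => heq ?_, hrest⟩
    rcases hcond with h | h | h | h
    exacts [.inl h, .inr ⟨inferInstance, .inl h.1⟩, .inr ⟨inferInstance, .inl h.1⟩,
      .inr ⟨inferInstance, .inr (Cardinal.infinite_iff.2 h.2.ge)⟩]
  · exact (hP₁ ⊤ φ hs hc hl).2.1 (.inr ⟨@MeasurableSingletonClass.mk 𝒴 ⊤ fun _ => trivial,
      .inr (Cardinal.infinite_iff.2 (Cardinal.aleph0_le_continuum.trans hcard))⟩)
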